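/- Let $R$ be a commutative noetherian ring, and let $A$ be a (commutative, non-negatively graded) DG $R$-algebra, homologically indexed, such that each $A_i$ is a free $R$-module of finite rank. Let $t\in R$, and assume that $R$ is $tR$-adically complete. Let $K^R(t)=(0\to Re\xrightarrow{e\mapsto t}R\to 0)$ be the Koszul complex on $t$, regarded as a DG $R$-algebra with $e^2=0$, and set $B=K^R(t)\otimes_R A$, a DG $R$-algebra equipped with the morphism $A\to B$, $a\mapsto 1\otimes a$. A DG module $N$ over $A$ or $B$ is called semi-free if it is bounded below ($N_i=0$ for $i\ll 0$) and has a semi-basis, that is, a set of homogeneous elements forming a basis of the underlying graded module over the underlying graded algebra. For DG $B$-modules $N,N'$ set $\operatorname{Ext}^i_B(N,N')=\operatorname{H}_{-i}(\operatorname{Hom}_B(F,N'))$, where $F\xrightarrow{\simeq}N$ is a semi-free resolution. Theorem. Let $N$ be a semi-free DG $B$-module with a semi-basis that is finite in each degree. If $\operatorname{Ext}^2_B(N,N)=0$, then $N$ is liftable to $A$ with semi-free lifting: there is a semi-free DG $A$-module $M$ such that $N\cong B\otimes_A M$ as DG $B$-modules. -/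

import Mathlib

open scoped TensorProduct DirectSum

section GradedModules

theorem map_unit_smul {X Y F : Type*} [AddCommGroup X] [AddCommGroup Y] [FunLike F X Y]
    [AddMonoidHomClass F X Y] (f : F) (u : ℤˣ) (x : X) : f (u • x) = u • f x := by
  rw [Units.smul_def, Units.smul_def, map_zsmul]

theorem unit_smul_mul {X : Type*} [Ring X] (u : ℤˣ) (x y : X) : (u • x) * y = u • (x * y) :=
  (map_unit_smul (AddMonoidHom.mulRight y) u x)

theorem mul_unit_smul {X : Type*} [Ring X] (u : ℤˣ) (x y : X) : x * (u • y) = u • (x * y) :=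
  (map_unit_smul (AddMonoidHom.mulLeft x) u y)

variable {R M N : Type*} [CommRing R] [AddCommGroup M] [Module R M] [AddCommGroup N] [Module R N]

theorem unit_smul_mem (S : Submodule R M) (u : ℤˣ) {x : M} (hx : x ∈ S) : u • x ∈ S := by
  rw [Units.smul_def]; exact zsmul_mem hx _

/-- A criterion for a family of submodules to be a grading. -/
theorem isInternal_of_coaction (ℳ : ℤ → Submodule R M) (htop : ⨆ i, ℳ i = ⊤)
    (ρ : M →ₗ[R] (ℤ →₀ M)) (hρ : ∀ i, ∀ x ∈ ℳ i, ρ x = Finsupp.single i x) :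
    DirectSum.IsInternal ℳ := by
  have key : ∀ x : ⨁ i, ℳ i, ∀ i, ρ (DirectSum.coeLinearMap ℳ x) i = x i := by
    intro x i
    induction x using DirectSum.induction_on with
    | zero => simp
    | of j y =>
      have h1 : DirectSum.coeLinearMap ℳ (DirectSum.of (fun i => ℳ i) j y) = y :=
        DirectSum.coeAddMonoidHom_of ℳ j y
      rw [h1, hρ j y y.2]
      by_cases h : j = i
      · subst h; simp
      · rw [Finsupp.single_eq_of_ne (Ne.symm h), DirectSum.of_eq_of_ne _ _ _ (Ne.symm h)]; rfl
    | add x y hx hy => simp [hx, hy]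
  constructor
  · intro x y hxy
    refine DFinsupp.ext fun i => Subtype.ext ?_
    change DirectSum.coeLinearMap ℳ x = DirectSum.coeLinearMap ℳ y at hxy
    rw [← key x i, ← key y i, hxy]
  · intro m
    have : m ∈ LinearMap.range (DirectSum.coeLinearMap ℳ) := by
      rw [DirectSum.range_coeLinearMap, htop]; trivial
    exact this

/-- The linear map `∑ mᵢ ↦ ∑ mᵢ Tⁱ` attached to a grading. -/
noncomputable def gradedCoaction (ℳ : ℤ → Submodule R M) [DirectSum.Decomposition ℳ] :
    M →ₗ[R] (ℤ →₀ M) :=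
  DirectSum.toModule R ℤ (ℤ →₀ M) (fun i => Finsupp.lsingle i ∘ₗ (ℳ i).subtype) ∘ₗ
    (DirectSum.decomposeLinearEquiv ℳ).toLinearMap

/-- The sign involution `m ↦ (-1)^|m| m` attached to a grading. -/
noncomputable def gradedSign (ℳ : ℤ → Submodule R M) [DirectSum.Decomposition ℳ] :
    M →ₗ[R] M :=
  DirectSum.toModule R ℤ M (fun i => i.negOnePow • (ℳ i).subtype) ∘ₗ
    (DirectSum.decomposeLinearEquiv ℳ).toLinearMap

theorem gradedCoaction_of_mem (ℳ : ℤ → Submodule R M) [DirectSum.Decomposition ℳ]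
    {i : ℤ} {x : M} (hx : x ∈ ℳ i) : gradedCoaction ℳ x = Finsupp.single i x := by
  have h : DirectSum.decomposeLinearEquiv ℳ x = DirectSum.lof R ℤ (fun i => ℳ i) i ⟨x, hx⟩ :=
    DirectSum.decompose_of_mem ℳ hx
  simp [gradedCoaction, h]

theorem gradedSign_of_mem (ℳ : ℤ → Submodule R M) [DirectSum.Decomposition ℳ]
    {i : ℤ} {x : M} (hx : x ∈ ℳ i) : gradedSign ℳ x = i.negOnePow • x := by
  have h : DirectSum.decomposeLinearEquiv ℳ x = DirectSum.lof R ℤ (fun i => ℳ i) i ⟨x, hx⟩ :=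
    DirectSum.decompose_of_mem ℳ hx
  simp only [gradedSign, LinearMap.comp_apply, LinearEquiv.coe_coe, h, DirectSum.toModule_lof]
  rfl

/-- The degree `n` part `⊕_{i+j=n} Mᵢ ⊗ Nⱼ` of a tensor product. -/
def tensorDeg (ℳ : ℤ → Submodule R M) (𝒩 : ℤ → Submodule R N) (n : ℤ) :
    Submodule R (M ⊗[R] N) :=
  Submodule.span R {x | ∃ i j : ℤ, i + j = n ∧ ∃ a ∈ ℳ i, ∃ b ∈ 𝒩 j, x = a ⊗ₜ[R] b}

theorem tmul_mem_tensorDeg {ℳ : ℤ → Submodule R M} {𝒩 : ℤ → Submodule R N} {i j n : ℤ}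
    {a : M} {b : N} (ha : a ∈ ℳ i) (hb : b ∈ 𝒩 j) (h : i + j = n) :
    a ⊗ₜ[R] b ∈ tensorDeg ℳ 𝒩 n :=
  Submodule.subset_span ⟨i, j, h, a, ha, b, hb, rfl⟩

theorem tensor_homogeneous_induction (ℳ : ℤ → Submodule R M) (𝒩 : ℤ → Submodule R N)
    [DirectSum.Decomposition ℳ] [DirectSum.Decomposition 𝒩] {P : M ⊗[R] N → Prop}
    (h : ∀ i j, ∀ a ∈ ℳ i, ∀ b ∈ 𝒩 j, P (a ⊗ₜ b)) (h0 : P 0)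
    (hadd : ∀ x y, P x → P y → P (x + y)) (x : M ⊗[R] N) : P x := by
  induction x with
  | zero => exact h0
  | add x y hx hy => exact hadd x y hx hy
  | tmul a b =>
    induction a using DirectSum.Decomposition.inductionOn ℳ with
    | zero => simpa using h0
    | add a a' ha ha' => rw [TensorProduct.add_tmul]; exact hadd _ _ ha ha'
    | homogeneous a =>
      induction b using DirectSum.Decomposition.inductionOn 𝒩 with
      | zero => simpa using h0
      | add a a' ha ha' => rw [TensorProduct.tmul_add]; exact hadd _ _ ha ha'
      | homogeneous b => exact h _ _ _ a.2 _ b.2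

theorem iSup_tensorDeg (ℳ : ℤ → Submodule R M) (𝒩 : ℤ → Submodule R N)
    [DirectSum.Decomposition ℳ] [DirectSum.Decomposition 𝒩] :
    ⨆ n, tensorDeg ℳ 𝒩 n = ⊤ := by
  refine Submodule.eq_top_iff'.2 fun x => ?_
  induction x using tensor_homogeneous_induction ℳ 𝒩 with
  | h i j a ha b hb => exact Submodule.mem_iSup_of_mem (i + j) (tmul_mem_tensorDeg ha hb rfl)
  | h0 => exact zero_mem _
  | hadd x y hx hy => exact add_mem hx hy

noncomputable def tensorCoaction (ℳ : ℤ → Submodule R M) (𝒩 : ℤ → Submodule R N)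
    [DirectSum.Decomposition ℳ] [DirectSum.Decomposition 𝒩] :
    M ⊗[R] N →ₗ[R] (ℤ →₀ M ⊗[R] N) :=
  Finsupp.lmapDomain (M ⊗[R] N) R (fun p : ℤ × ℤ => p.1 + p.2) ∘ₗ
    (finsuppTensorFinsupp R R M N ℤ ℤ).toLinearMap ∘ₗ
      TensorProduct.map (gradedCoaction ℳ) (gradedCoaction 𝒩)

theorem tensorCoaction_of_mem (ℳ : ℤ → Submodule R M) (𝒩 : ℤ → Submodule R N)
    [DirectSum.Decomposition ℳ] [DirectSum.Decomposition 𝒩] {n : ℤ} {x : M ⊗[R] N}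
    (hx : x ∈ tensorDeg ℳ 𝒩 n) : tensorCoaction ℳ 𝒩 x = Finsupp.single n x := by
  induction hx using Submodule.span_induction with
  | mem x hx =>
    obtain ⟨i, j, rfl, a, ha, b, hb, rfl⟩ := hx
    simp [tensorCoaction, gradedCoaction_of_mem ℳ ha, gradedCoaction_of_mem 𝒩 hb]
  | zero => simp
  | add x y _ _ hx hy => simp [hx, hy]
  | smul r x _ hx => simp [hx]

theorem tensorDeg_isInternal (ℳ : ℤ → Submodule R M) (𝒩 : ℤ → Submodule R N)
    [DirectSum.Decomposition ℳ] [DirectSum.Decomposition 𝒩] :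
    DirectSum.IsInternal (tensorDeg ℳ 𝒩) :=
  isInternal_of_coaction _ (iSup_tensorDeg ℳ 𝒩) (tensorCoaction ℳ 𝒩)
    fun _ _ hx => tensorCoaction_of_mem ℳ 𝒩 hx

/-- The differential `a ⊗ b ↦ da ⊗ b + (-1)^|a| a ⊗ db` of a tensor product. -/
noncomputable def tensorD (ℳ : ℤ → Submodule R M) [DirectSum.Decomposition ℳ]
    (dM : M →ₗ[R] M) (dN : N →ₗ[R] N) : M ⊗[R] N →ₗ[R] M ⊗[R] N :=
  TensorProduct.map dM LinearMap.id + TensorProduct.map (gradedSign ℳ) dN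

theorem tensorD_tmul (ℳ : ℤ → Submodule R M) [DirectSum.Decomposition ℳ]
    (dM : M →ₗ[R] M) (dN : N →ₗ[R] N) {i : ℤ} {a : M} (ha : a ∈ ℳ i) (b : N) :
    tensorD ℳ dM dN (a ⊗ₜ b) = dM a ⊗ₜ b + i.negOnePow • (a ⊗ₜ[R] dN b) := by
  rw [tensorD, LinearMap.add_apply, TensorProduct.map_tmul, TensorProduct.map_tmul,
    gradedSign_of_mem ℳ ha]
  simp only [LinearMap.id_apply]
  rcases Int.units_eq_one_or i.negOnePow with h | h <;> simp [h, TensorProduct.neg_tmul]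

theorem tensorD_mem {ℳ : ℤ → Submodule R M} {𝒩 : ℤ → Submodule R N}
    [DirectSum.Decomposition ℳ] {dM : M →ₗ[R] M} {dN : N →ₗ[R] N}
    (hM : ∀ i, ∀ a ∈ ℳ i, dM a ∈ ℳ (i - 1)) (hN : ∀ i, ∀ a ∈ 𝒩 i, dN a ∈ 𝒩 (i - 1))
    {n : ℤ} {x : M ⊗[R] N} (hx : x ∈ tensorDeg ℳ 𝒩 n) :
    tensorD ℳ dM dN x ∈ tensorDeg ℳ 𝒩 (n - 1) := by
  induction hx using Submodule.span_induction with
  | mem x hx =>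
    obtain ⟨i, j, rfl, a, ha, b, hb, rfl⟩ := hx
    rw [tensorD_tmul ℳ _ _ ha]
    refine add_mem (tmul_mem_tensorDeg (hM _ _ ha) hb (by ring)) ?_
    exact unit_smul_mem _ _ (tmul_mem_tensorDeg ha (hN _ _ hb) (by ring))
  | zero => simp
  | add x y _ _ hx hy => rw [map_add]; exact add_mem hx hy
  | smul r x _ hx => rw [map_smul]; exact Submodule.smul_mem _ _ hx

theorem tensorD_tensorD {ℳ : ℤ → Submodule R M} {𝒩 : ℤ → Submodule R N}
    [DirectSum.Decomposition ℳ] [DirectSum.Decomposition 𝒩] {dM : M →ₗ[R] M} {dN : N →ₗ[R] N}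
    (hM : ∀ i, ∀ a ∈ ℳ i, dM a ∈ ℳ (i - 1)) (hMM : ∀ a, dM (dM a) = 0)
    (hNN : ∀ a, dN (dN a) = 0) (x : M ⊗[R] N) :
    tensorD ℳ dM dN (tensorD ℳ dM dN x) = 0 := by
  induction x using tensor_homogeneous_induction ℳ 𝒩 with
  | h i j a ha b hb =>
    rw [tensorD_tmul ℳ _ _ ha, map_add, tensorD_tmul ℳ _ _ (hM _ _ ha),
      map_unit_smul, tensorD_tmul ℳ _ _ ha, hMM, hNN, Int.negOnePow_sub]
    simp
  | h0 => simp
  | hadd x y hx hy => simp [hx, hy]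

end GradedModules

/-- A commutative differential graded `R`-algebra, homologically graded. The type `A` is the
underlying algebra `⊕ᵢ Aᵢ` and `deg i` is its degree `i` part `Aᵢ`. -/
structure DGAlgebra (R A : Type*) [CommRing R] [Ring A] [Algebra R A] where
  deg : ℤ → Submodule R A
  graded : GradedAlgebra deg
  d : A →ₗ[R] A
  d_mem : ∀ i, ∀ a ∈ deg i, d a ∈ deg (i - 1)
  d_d : ∀ a, d (d a) = 0
  leibniz : ∀ i, ∀ a ∈ deg i, ∀ b, d (a * b) = d a * b + i.negOnePow • (a * d b)
  graded_comm : ∀ i j, ∀ a ∈ deg i, ∀ b ∈ deg j, a * b = (i * j).negOnePow • (b * a)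
  sq_zero : ∀ i, Odd i → ∀ a ∈ deg i, a * a = 0
  nonneg : ∀ i < 0, deg i = ⊥

namespace DGAlgebra

variable {R A B : Type*} [CommRing R] [Ring A] [Algebra R A] [Ring B] [Algebra R B]

noncomputable instance (𝒜 : DGAlgebra R A) : GradedAlgebra 𝒜.deg := 𝒜.graded

theorem d_one (𝒜 : DGAlgebra R A) : 𝒜.d 1 = 0 := by
  have h := 𝒜.leibniz 0 1 (SetLike.GradedOne.one_mem) 1
  simpa using h

/-- A morphism of DG `R`-algebras. -/
structure Hom (𝒜 : DGAlgebra R A) (ℬ : DGAlgebra R B) where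
  toAlgHom : A →ₐ[R] B
  map_mem : ∀ i, ∀ a ∈ 𝒜.deg i, toAlgHom a ∈ ℬ.deg i
  map_d : ∀ a, toAlgHom (𝒜.d a) = ℬ.d (toAlgHom a)

section Tensor

variable (𝒜 : DGAlgebra R A) (ℬ : DGAlgebra R B)

/-- The underlying algebra of `A ⊗ B`, with `(a ⊗ b)(a' ⊗ b') = (-1)^(|b||a'|) aa' ⊗ bb'`. -/
noncomputable abbrev TensorType : Type _ := GradedTensorProduct R 𝒜.deg ℬ.deg

/-- The degree `n` part `⊕_{i+j=n} Aᵢ ⊗ Bⱼ` of the algebra `A ⊗ B`. -/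
noncomputable def tensorGrading (n : ℤ) : Submodule R (TensorType 𝒜 ℬ) :=
  (tensorDeg 𝒜.deg ℬ.deg n).comap (GradedTensorProduct.of R 𝒜.deg ℬ.deg).symm.toLinearMap

/-- The differential `a ⊗ b ↦ da ⊗ b + (-1)^|a| a ⊗ db` on the algebra `A ⊗ B`. -/
noncomputable def tensorDiff : TensorType 𝒜 ℬ →ₗ[R] TensorType 𝒜 ℬ :=
  (GradedTensorProduct.of R 𝒜.deg ℬ.deg).toLinearMap ∘ₗ tensorD 𝒜.deg 𝒜.d ℬ.d ∘ₗ
    (GradedTensorProduct.of R 𝒜.deg ℬ.deg).symm.toLinearMap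

theorem tmul_mem_tensorGrading {i j n : ℤ} {a : A} {b : B} (ha : a ∈ 𝒜.deg i)
    (hb : b ∈ ℬ.deg j) (h : i + j = n) :
    (GradedTensorProduct.tmul R a b : TensorType 𝒜 ℬ) ∈ tensorGrading 𝒜 ℬ n :=
  tmul_mem_tensorDeg (R := R) ha hb h

theorem tensorDiff_tmul {i : ℤ} {a : A} (ha : a ∈ 𝒜.deg i) (b : B) :
    tensorDiff 𝒜 ℬ (GradedTensorProduct.tmul R a b) =
      GradedTensorProduct.tmul R (𝒜.d a) b +
        i.negOnePow • GradedTensorProduct.tmul R a (ℬ.d b) :=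
  tensorD_tmul 𝒜.deg 𝒜.d ℬ.d ha b

theorem tensor_mul {j i : ℤ} (a : A) {b : B} (hb : b ∈ ℬ.deg j) {a' : A} (ha' : a' ∈ 𝒜.deg i)
    (b' : B) :
    (GradedTensorProduct.tmul R a b * GradedTensorProduct.tmul R a' b' : TensorType 𝒜 ℬ) =
      (j * i).negOnePow • GradedTensorProduct.tmul R (a * a') (b * b') :=
  GradedTensorProduct.tmul_coe_mul_coe_tmul (R := R) 𝒜.deg ℬ.deg a ⟨b, hb⟩ ⟨a', ha'⟩ b'

theorem tensorGrading_induction {n : ℤ} {P : (x : TensorType 𝒜 ℬ) → x ∈ tensorGrading 𝒜 ℬ n → Prop}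
    (h : ∀ i j, ∀ hij : i + j = n, ∀ a, ∀ ha : a ∈ 𝒜.deg i, ∀ b, ∀ hb : b ∈ ℬ.deg j,
      P (GradedTensorProduct.tmul R a b) (tmul_mem_tensorGrading 𝒜 ℬ ha hb hij))
    (h0 : P 0 (zero_mem _))
    (hadd : ∀ x y, ∀ hx : x ∈ tensorGrading 𝒜 ℬ n, ∀ hy : y ∈ tensorGrading 𝒜 ℬ n,
      P x hx → P y hy → P (x + y) (add_mem hx hy))
    {x : TensorType 𝒜 ℬ} (hx : x ∈ tensorGrading 𝒜 ℬ n) : P x hx := by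
  refine Submodule.closure_induction (p := fun x hx => P x hx) h0 ?_ ?_
    (show x ∈ Submodule.span R _ from hx)
  · exact fun x y hx hy => hadd x y hx hy
  · rintro r _ ⟨i, j, hij, a, ha, b, hb, rfl⟩
    exact h i j hij (r • a) (Submodule.smul_mem _ _ ha) b hb

theorem tensor_induction {P : TensorType 𝒜 ℬ → Prop}
    (h : ∀ i j, ∀ a ∈ 𝒜.deg i, ∀ b ∈ ℬ.deg j, P (GradedTensorProduct.tmul R a b))
    (h0 : P 0) (hadd : ∀ x y, P x → P y → P (x + y)) (x : TensorType 𝒜 ℬ) : P x :=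
  tensor_homogeneous_induction (R := R) 𝒜.deg ℬ.deg (P := P) h h0 hadd x

theorem tensorGrading_isInternal : DirectSum.IsInternal (tensorGrading 𝒜 ℬ) :=
  tensorDeg_isInternal 𝒜.deg ℬ.deg

theorem tensorGrading_gradedMonoid : SetLike.GradedMonoid (tensorGrading 𝒜 ℬ) where
  one_mem := tmul_mem_tensorGrading 𝒜 ℬ SetLike.GradedOne.one_mem SetLike.GradedOne.one_mem
    (add_zero 0)
  mul_mem := by
    intro m n x y hx hy
    induction hx using tensorGrading_induction with
    | h i j hij a ha b hb =>
      induction hy using tensorGrading_induction with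
      | h i' j' hij' a' ha' b' hb' =>
        rw [tensor_mul 𝒜 ℬ a hb ha' b']
        exact unit_smul_mem _ _ (tmul_mem_tensorGrading 𝒜 ℬ (SetLike.mul_mem_graded ha ha')
          (SetLike.mul_mem_graded hb hb') (by omega))
      | h0 => simp
      | hadd x y _ _ hx hy => rw [mul_add]; exact add_mem hx hy
    | h0 => simp
    | hadd x y _ _ hx hy => rw [add_mul]; exact add_mem hx hy

theorem tensor_leibniz (n : ℤ) (x : TensorType 𝒜 ℬ) (hx : x ∈ tensorGrading 𝒜 ℬ n)
    (y : TensorType 𝒜 ℬ) :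
    tensorDiff 𝒜 ℬ (x * y) = tensorDiff 𝒜 ℬ x * y + n.negOnePow • (x * tensorDiff 𝒜 ℬ y) := by
  induction hx using tensorGrading_induction with
  | h i j hij a ha b hb =>
    induction y using tensor_induction with
    | h i' j' a' ha' b' hb' =>
      subst hij
      have e1 := tensor_mul 𝒜 ℬ a hb ha' b'
      have e2 := tensor_mul 𝒜 ℬ (𝒜.d a) hb ha' b'
      have e3 := tensor_mul 𝒜 ℬ a (ℬ.d_mem _ _ hb) ha' b'
      have e4 := tensor_mul 𝒜 ℬ a hb (𝒜.d_mem _ _ ha') b'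
      have e5 := tensor_mul 𝒜 ℬ a hb ha' (ℬ.d b')
      rw [e1, map_unit_smul, tensorDiff_tmul 𝒜 ℬ (SetLike.mul_mem_graded ha ha'),
        tensorDiff_tmul 𝒜 ℬ ha, tensorDiff_tmul 𝒜 ℬ ha', add_mul, mul_add, unit_smul_mul,
        mul_unit_smul, e2, e3, e4, e5, 𝒜.leibniz _ _ ha, ℬ.leibniz _ _ hb]
      simp only [GradedTensorProduct.tmul, TensorProduct.add_tmul, TensorProduct.tmul_add, map_add]
      have s1 : ∀ (u : ℤˣ) (x : A) (y : B), (u • x) ⊗ₜ[R] y = u • (x ⊗ₜ[R] y) := by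
        intro u x y
        rcases Int.units_eq_one_or u with h | h <;> simp [h, TensorProduct.neg_tmul]
      have s2 : ∀ (u : ℤˣ) (x : A) (y : B), x ⊗ₜ[R] (u • y) = u • (x ⊗ₜ[R] y) := by
        intro u x y
        rcases Int.units_eq_one_or u with h | h <;> simp [h, TensorProduct.tmul_neg]
      simp only [s1, s2, map_unit_smul, smul_add, smul_smul, ← Int.negOnePow_add]
      have p1 : (j * i' + (i + i')).negOnePow = (i + (j - 1) * i').negOnePow := by
        rw [Int.negOnePow_eq_iff]; exact ⟨i', by ring⟩
      have p2 : (j * i' + i).negOnePow = (i + j + j * (i' - 1)).negOnePow := by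
        rw [Int.negOnePow_eq_iff]; exact ⟨0, by ring⟩
      have p3 : (j * i' + (i + i' + j)).negOnePow = (i + j + (i' + j * i')).negOnePow := by
        congr 1; ring
      rw [p1, p2, p3]
      abel
    | h0 => simp
    | hadd x y hx hy => simp only [mul_add, map_add, hx, hy, smul_add]; abel
  | h0 => simp
  | hadd x y _ _ hx hy => simp only [add_mul, map_add, hx, hy, smul_add]; abel

theorem tensor_graded_comm (m n : ℤ) (x : TensorType 𝒜 ℬ) (hx : x ∈ tensorGrading 𝒜 ℬ m)
    (y : TensorType 𝒜 ℬ) (hy : y ∈ tensorGrading 𝒜 ℬ n) :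
    x * y = (m * n).negOnePow • (y * x) := by
  induction hx using tensorGrading_induction with
  | h i j hij a ha b hb =>
    induction hy using tensorGrading_induction with
    | h i' j' hij' a' ha' b' hb' =>
      subst hij hij'
      rw [tensor_mul 𝒜 ℬ a hb ha' b', tensor_mul 𝒜 ℬ a' hb' ha b,
        𝒜.graded_comm _ _ _ ha _ ha', ℬ.graded_comm _ _ _ hb _ hb']
      have s1 : ∀ (u v : ℤˣ) (x : A) (y : B), (u • x) ⊗ₜ[R] (v • y) = (u * v) • (x ⊗ₜ[R] y) := by
        intro u v x y
        rcases Int.units_eq_one_or u with h | h <;> rcases Int.units_eq_one_or v with h' | h' <;>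
          simp [h, h', TensorProduct.neg_tmul, TensorProduct.tmul_neg]
      simp only [GradedTensorProduct.tmul, s1, map_unit_smul, smul_smul, ← Int.negOnePow_add]
      congr 1
      rw [Int.negOnePow_eq_iff]
      exact ⟨-(i * j'), by ring⟩
    | h0 => simp
    | hadd x y _ _ hx hy => simp only [mul_add, add_mul, hx, hy, smul_add]
  | h0 => simp
  | hadd x y _ _ hx hy => simp only [mul_add, add_mul, hx, hy, smul_add]

theorem tensor_sq_zero (n : ℤ) (hn : Odd n) (x : TensorType 𝒜 ℬ)
    (hx : x ∈ tensorGrading 𝒜 ℬ n) : x * x = 0 := by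
  induction hx using tensorGrading_induction with
  | h i j hij a ha b hb =>
    rw [tensor_mul 𝒜 ℬ a hb ha b]
    subst hij
    rcases Int.even_or_odd i with hi | hi
    · have hj : Odd j := by
        by_contra h
        exact (Int.not_odd_iff_even.2 (hi.add (Int.not_odd_iff_even.1 h))) hn
      simp [GradedTensorProduct.tmul, ℬ.sq_zero j hj b hb]
    · simp [GradedTensorProduct.tmul, 𝒜.sq_zero i hi a ha]
  | h0 => simp
  | hadd x y hxm hym hx hy =>
    have h := tensor_graded_comm 𝒜 ℬ n n x hxm y hym
    rw [Int.negOnePow_odd _ (hn.mul hn)] at h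
    simp [add_mul, mul_add, hx, hy, h]

/-- The tensor product of two DG `R`-algebras. -/
noncomputable def tensor : DGAlgebra R (TensorType 𝒜 ℬ) where
  deg := tensorGrading 𝒜 ℬ
  graded :=
    { tensorGrading_gradedMonoid 𝒜 ℬ, (tensorGrading_isInternal 𝒜 ℬ).chooseDecomposition with }
  d := tensorDiff 𝒜 ℬ
  d_mem _ _ hx := tensorD_mem (R := R) 𝒜.d_mem ℬ.d_mem hx
  d_d := tensorD_tensorD (𝒩 := ℬ.deg) 𝒜.d_mem 𝒜.d_d ℬ.d_d
  leibniz := tensor_leibniz 𝒜 ℬ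
  graded_comm := tensor_graded_comm 𝒜 ℬ
  sq_zero := tensor_sq_zero 𝒜 ℬ
  nonneg n hn := by
    refine (Submodule.eq_bot_iff _).2 fun x hx => ?_
    induction hx using tensorGrading_induction with
    | h i j hij a ha b hb =>
      rcases lt_or_ge i 0 with hi | hi
      · rw [𝒜.nonneg i hi, Submodule.mem_bot] at ha
        simp [GradedTensorProduct.tmul, ha]
      · rw [ℬ.nonneg j (by omega), Submodule.mem_bot] at hb
        simp [GradedTensorProduct.tmul, hb]
    | h0 => rfl
    | hadd x y _ _ hx hy => rw [hx, hy, add_zero]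

/-- The morphism of DG algebras `B → A ⊗ B`, `b ↦ 1 ⊗ b`. -/
noncomputable def tensorInclude : Hom ℬ (tensor 𝒜 ℬ) where
  toAlgHom := GradedTensorProduct.includeRight 𝒜.deg ℬ.deg
  map_mem _ _ hb := tmul_mem_tensorGrading 𝒜 ℬ SetLike.GradedOne.one_mem hb (zero_add _)
  map_d b := by
    have h := tensorDiff_tmul 𝒜 ℬ (i := 0) (a := 1) SetLike.GradedOne.one_mem b
    rw [𝒜.d_one] at h
    refine Eq.trans ?_ h.symm
    simp [GradedTensorProduct.tmul]

end Tensor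

section Koszul

/-- The grading of the Koszul complex on one element: `R · 1` in degree `0`, `R · ε` in
degree `1`. -/
def koszulDeg (R : Type*) [CommRing R] (n : ℤ) : Submodule R (DualNumber R) where
  carrier := {x | (n ≠ 0 → x.fst = 0) ∧ (n ≠ 1 → x.snd = 0)}
  zero_mem' := by simp
  add_mem' := by
    rintro x y ⟨hx, hx'⟩ ⟨hy, hy'⟩
    exact ⟨fun h => by simp [hx h, hy h], fun h => by simp [hx' h, hy' h]⟩
  smul_mem' := by
    rintro r x ⟨hx, hx'⟩
    exact ⟨fun h => by simp [hx h], fun h => by simp [hx' h]⟩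

theorem koszulDeg_isInternal (R : Type*) [CommRing R] :
    DirectSum.IsInternal (koszulDeg R) := by
  refine isInternal_of_coaction _ ?_
    (Finsupp.lsingle 0 ∘ₗ (TrivSqZeroExt.inlAlgHom R R R).toLinearMap ∘ₗ
        (TrivSqZeroExt.fstHom R R R).toLinearMap +
      Finsupp.lsingle 1 ∘ₗ TrivSqZeroExt.inrHom R R ∘ₗ TrivSqZeroExt.sndHom R R) ?_
  · refine Submodule.eq_top_iff'.2 fun x => ?_
    rw [← TrivSqZeroExt.inl_fst_add_inr_snd_eq x]
    refine add_mem (Submodule.mem_iSup_of_mem 0 ?_) (Submodule.mem_iSup_of_mem 1 ?_)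
    · exact ⟨fun h => absurd rfl h, fun _ => by simp⟩
    · exact ⟨fun _ => by simp, fun h => absurd rfl h⟩
  · rintro i x ⟨h0, h1⟩
    have hx := TrivSqZeroExt.inl_fst_add_inr_snd_eq x
    by_cases hi0 : i = 0
    · subst hi0
      have h : x.snd = 0 := h1 (by norm_num)
      rw [h] at hx
      simp at hx
      simp [h, hx]
    · by_cases hi1 : i = 1
      · subst hi1
        have h : x.fst = 0 := h0 (by norm_num)
        rw [h] at hx
        simp at hx
        simp [h, hx]
      · have hz : x = 0 := by
          rw [← hx, h0 hi0, h1 hi1]; simp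
        simp [hz]

theorem koszulDeg_gradedMonoid (R : Type*) [CommRing R] : SetLike.GradedMonoid (koszulDeg R) where
  one_mem := ⟨fun h => absurd rfl h, fun _ => by simp⟩
  mul_mem := by
    rintro m n x y ⟨hx, hx'⟩ ⟨hy, hy'⟩
    constructor
    · intro h
      rw [TrivSqZeroExt.fst_mul]
      by_cases hm : m = 0
      · rw [hy (by omega), mul_zero]
      · rw [hx hm, zero_mul]
    · intro h
      rw [TrivSqZeroExt.snd_mul]
      have h1 : x.fst * y.snd = 0 := by
        by_cases hm : m = 0
        · rw [hy' (by omega), mul_zero]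
        · rw [hx hm, zero_mul]
      have h2 : y.fst * x.snd = 0 := by
        by_cases hm : n = 0
        · rw [hx' (by omega), mul_zero]
        · rw [hy hm, zero_mul]
      simp [h1, mul_comm _ y.fst, h2]

/-- The Koszul complex `K^R(t) = (0 → R ε → R → 0)`, `ε ↦ t`, as a DG `R`-algebra; its
underlying algebra is `R ⊕ R ε` with `ε² = 0`. -/
noncomputable def koszul {R : Type*} [CommRing R] (t : R) : DGAlgebra R (DualNumber R) where
  deg := koszulDeg R
  graded :=
    { koszulDeg_gradedMonoid R, (koszulDeg_isInternal R).chooseDecomposition with }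
  d :=
    { toFun := fun x => TrivSqZeroExt.inl (t * x.snd)
      map_add' := fun x y => by simp [mul_add]
      map_smul' := fun r x => by
        ext <;> simp; ring }
  d_mem := by
    rintro i x ⟨hx, hx'⟩
    exact ⟨fun h => by simp [hx' (show i ≠ 1 by omega)], fun _ => by simp⟩
  d_d x := by simp
  leibniz := by
    rintro i x ⟨hx, hx'⟩ y
    by_cases h0 : i = 0
    · subst h0
      ext
      · simp [hx' (by norm_num)]; ring
      · simp [hx' (by norm_num)]
    · by_cases h1 : i = 1
      · subst h1
        ext
        · simp [hx (by norm_num)]; ring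
        · simp [hx (by norm_num)]; ring
      · have hz : x = 0 := TrivSqZeroExt.ext (hx h0) (hx' h1)
        simp [hz]
  graded_comm := by
    rintro i j x ⟨hx, hx'⟩ y ⟨hy, hy'⟩
    by_cases h0 : i * j = 0
    · rw [h0]; simp [mul_comm x y]
    · have hx0 : x.fst = 0 := hx (by rintro rfl; simp at h0)
      have hy0 : y.fst = 0 := hy (by rintro rfl; simp at h0)
      have e1 : x * y = 0 := by ext <;> simp [hx0, hy0]
      rw [mul_comm y x, e1, smul_zero]
  sq_zero := by
    rintro i hi x ⟨hx, hx'⟩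
    have hx0 : x.fst = 0 := hx (by rintro rfl; simp at hi)
    ext <;> simp [hx0]
  nonneg := by
    intro i hi
    refine (Submodule.eq_bot_iff _).2 ?_
    rintro x ⟨hx, hx'⟩
    exact TrivSqZeroExt.ext (hx (by omega)) (hx' (by omega))

end Koszul

end DGAlgebra

/-- A DG module over the DG `R`-algebra `𝒜`. The type `M` is the underlying module `⊕ᵢ Mᵢ` over the
underlying algebra of `𝒜`, and `deg i` is its degree `i` part `Mᵢ`. -/
structure DGModule {R A : Type*} [CommRing R] [Ring A] [Algebra R A] (𝒜 : DGAlgebra R A)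
    (M : Type*) [AddCommGroup M] [Module R M] [Module A M] [IsScalarTower R A M] where
  deg : ℤ → Submodule R M
  isInternal : DirectSum.IsInternal deg
  smul_mem : ∀ i j, ∀ a ∈ 𝒜.deg i, ∀ m ∈ deg j, a • m ∈ deg (i + j)
  d : M →ₗ[R] M
  d_mem : ∀ i, ∀ m ∈ deg i, d m ∈ deg (i - 1)
  d_d : ∀ m, d (d m) = 0
  leibniz : ∀ i, ∀ a ∈ 𝒜.deg i, ∀ m, d (a • m) = 𝒜.d a • m + i.negOnePow • (a • d m)

namespace DGModule

variable {R A : Type*} [CommRing R] [Ring A] [Algebra R A] {𝒜 : DGAlgebra R A}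
variable {M : Type*} [AddCommGroup M] [Module R M] [Module A M] [IsScalarTower R A M]
variable {N : Type*} [AddCommGroup N] [Module R N] [Module A N] [IsScalarTower R A N]
variable {F : Type*} [AddCommGroup F] [Module R F] [Module A F] [IsScalarTower R A F]

noncomputable instance (ℳ : DGModule 𝒜 M) : DirectSum.Decomposition ℳ.deg :=
  ℳ.isInternal.chooseDecomposition

/-- `Mᵢ = 0` for `i ≪ 0`. -/
def IsBoundedBelow (ℳ : DGModule 𝒜 M) : Prop :=
  ∃ n : ℤ, ∀ i < n, ℳ.deg i = ⊥

/-- A semi-basis: a set of homogeneous elements that is a basis of the underlying module over the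
underlying algebra. -/
structure IsSemibasis (ℳ : DGModule 𝒜 M) (E : Set M) : Prop where
  homogeneous : ∀ e ∈ E, ∃ i, e ∈ ℳ.deg i
  linearIndependent : LinearIndependent A ((↑) : E → M)
  span_eq_top : Submodule.span A E = ⊤

/-- A (bounded below) semi-free DG module. -/
def IsSemifree (ℳ : DGModule 𝒜 M) : Prop :=
  ℳ.IsBoundedBelow ∧ ∃ E : Set M, ℳ.IsSemibasis E

/-- A semi-free DG module that has a semi-basis with finitely many elements in each degree. -/
def IsDegreewiseFiniteSemifree (ℳ : DGModule 𝒜 M) : Prop :=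
  ℳ.IsBoundedBelow ∧ ∃ E : Set M, ℳ.IsSemibasis E ∧ ∀ i, (E ∩ ℳ.deg i).Finite

section Homology

/-- The cycles of degree `i`. -/
def cycles (ℳ : DGModule 𝒜 M) (i : ℤ) : Submodule R M := ℳ.deg i ⊓ LinearMap.ker ℳ.d

/-- The boundaries of degree `i`. -/
def boundaries (ℳ : DGModule 𝒜 M) (i : ℤ) : Submodule R M := (ℳ.deg (i + 1)).map ℳ.d

theorem boundaries_le_cycles (ℳ : DGModule 𝒜 M) (i : ℤ) : ℳ.boundaries i ≤ ℳ.cycles i := by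
  rintro _ ⟨x, hx, rfl⟩
  exact ⟨by simpa using ℳ.d_mem _ x hx, ℳ.d_d x⟩

/-- The homology module `Hᵢ(M)`. -/
abbrev Homology (ℳ : DGModule 𝒜 M) (i : ℤ) : Type _ :=
  ↥(ℳ.cycles i) ⧸ (ℳ.boundaries i).submoduleOf (ℳ.cycles i)

end Homology

/-- A morphism of DG modules. -/
structure Hom (ℳ : DGModule 𝒜 M) (𝒩 : DGModule 𝒜 N) where
  toLinearMap : M →ₗ[A] N
  map_mem : ∀ i, ∀ m ∈ ℳ.deg i, toLinearMap m ∈ 𝒩.deg i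
  map_d : ∀ m, toLinearMap (ℳ.d m) = 𝒩.d (toLinearMap m)

namespace Hom

variable {ℳ : DGModule 𝒜 M} {𝒩 : DGModule 𝒜 N}

/-- The restriction of a morphism to cycles of degree `i`. -/
def cyclesMap (f : Hom ℳ 𝒩) (i : ℤ) : ℳ.cycles i →ₗ[R] 𝒩.cycles i :=
  (f.toLinearMap.restrictScalars R).restrict fun x hx =>
    ⟨f.map_mem i x hx.1, by
      have h : ℳ.d x = 0 := hx.2
      change 𝒩.d (f.toLinearMap x) = 0
      rw [← f.map_d, h, map_zero]⟩

/-- The map induced on the homology modules of degree `i`. -/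
def homologyMap (f : Hom ℳ 𝒩) (i : ℤ) : ℳ.Homology i →ₗ[R] 𝒩.Homology i :=
  Submodule.mapQ _ _ (f.cyclesMap i) (by
    rintro ⟨x, hx⟩ ⟨y, hy, hyx⟩
    exact ⟨f.toLinearMap y, f.map_mem _ y hy, by
      rw [← f.map_d, hyx]; rfl⟩)

def IsQuasiIso (f : Hom ℳ 𝒩) : Prop := ∀ i, Function.Bijective (f.homologyMap i)

end Hom

/-- An isomorphism of DG modules. -/
structure Iso (ℳ : DGModule 𝒜 M) (𝒩 : DGModule 𝒜 N) where
  toLinearEquiv : M ≃ₗ[A] N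
  map_mem : ∀ i, ∀ m ∈ ℳ.deg i, toLinearEquiv m ∈ 𝒩.deg i
  map_d : ∀ m, toLinearEquiv (ℳ.d m) = 𝒩.d (toLinearEquiv m)

section HomComplex

/-- `Hom_A(M, N)ₙ`: the DG module homomorphisms of degree `n`. -/
def homDeg (ℳ : DGModule 𝒜 M) (𝒩 : DGModule 𝒜 N) (n : ℤ) : Submodule R (M →ₗ[R] N) where
  carrier := {f | (∀ j, ∀ m ∈ ℳ.deg j, f m ∈ 𝒩.deg (j + n)) ∧
    ∀ i, ∀ a ∈ 𝒜.deg i, ∀ m, f (a • m) = (n * i).negOnePow • (a • f m)}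
  zero_mem' := by simp
  add_mem' := by
    rintro f g ⟨hf, hf'⟩ ⟨hg, hg'⟩
    refine ⟨fun j m hm => add_mem (hf j m hm) (hg j m hm), fun i a ha m => ?_⟩
    rw [LinearMap.add_apply, LinearMap.add_apply, hf' i a ha, hg' i a ha, smul_add, smul_add]
  smul_mem' := by
    rintro r f ⟨hf, hf'⟩
    refine ⟨fun j m hm => Submodule.smul_mem _ r (hf j m hm), fun i a ha m => ?_⟩
    rw [LinearMap.smul_apply, LinearMap.smul_apply, hf' i a ha, smul_algebra_smul_comm]
    exact map_unit_smul (DistribSMul.toAddMonoidHom N r) _ _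

/-- The differential `f ↦ ∂f - (-1)ⁿ f∂` of the Hom complex on homomorphisms of degree `n`. -/
def homD (ℳ : DGModule 𝒜 M) (𝒩 : DGModule 𝒜 N) (n : ℤ) : (M →ₗ[R] N) →ₗ[R] (M →ₗ[R] N) where
  toFun f := 𝒩.d ∘ₗ f - n.negOnePow • (f ∘ₗ ℳ.d)
  map_add' f g := by
    rw [LinearMap.comp_add, LinearMap.add_comp, smul_add]; abel
  map_smul' r f := by
    rcases Int.units_eq_one_or n.negOnePow with h | h <;>
      ext <;> simp [h, smul_sub, smul_add]

theorem homD_apply (ℳ : DGModule 𝒜 M) (𝒩 : DGModule 𝒜 N) (n : ℤ) (f : M →ₗ[R] N) (m : M) :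
    homD ℳ 𝒩 n f m = 𝒩.d (f m) - n.negOnePow • f (ℳ.d m) := rfl

theorem homD_mem (ℳ : DGModule 𝒜 M) (𝒩 : DGModule 𝒜 N) {n : ℤ} {f : M →ₗ[R] N}
    (hf : f ∈ homDeg ℳ 𝒩 n) : homD ℳ 𝒩 n f ∈ homDeg ℳ 𝒩 (n - 1) := by
  obtain ⟨h1, h2⟩ := hf
  refine ⟨fun j m hm => ?_, fun i a ha m => ?_⟩
  · rw [homD_apply]
    refine sub_mem ?_ (unit_smul_mem _ _ ?_)
    · simpa [add_sub_assoc] using 𝒩.d_mem _ _ (h1 j m hm)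
    · have := h1 _ _ (ℳ.d_mem j m hm)
      rwa [show j - 1 + n = j + (n - 1) by ring] at this
  · have s : ∀ (u : ℤˣ) (x : N), a • (u • x) = u • (a • x) := fun u x =>
      map_unit_smul (DistribSMul.toAddMonoidHom N a) u x
    rw [homD_apply, homD_apply, h2 i a ha, ℳ.leibniz i a ha, map_unit_smul, 𝒩.leibniz i a ha,
      map_add, map_unit_smul, h2 i a ha, h2 (i - 1) _ (𝒜.d_mem i a ha), smul_sub, s]
    simp only [smul_add, smul_sub, smul_smul, ← Int.negOnePow_add]
    have p1 : (n + n * (i - 1)).negOnePow = (n * i).negOnePow := by congr 1; ring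
    have p2 : (n * i + i).negOnePow = ((n - 1) * i).negOnePow := by
      rw [Int.negOnePow_eq_iff]; exact ⟨i, by ring⟩
    have p3 : (n + (i + n * i)).negOnePow = ((n - 1) * i + n).negOnePow := by
      rw [Int.negOnePow_eq_iff]; exact ⟨i, by ring⟩
    rw [p1, p2, p3]
    abel

theorem homD_homD (ℳ : DGModule 𝒜 M) (𝒩 : DGModule 𝒜 N) (n : ℤ) (f : M →ₗ[R] N) :
    homD ℳ 𝒩 (n - 1) (homD ℳ 𝒩 n f) = 0 := by
  ext m
  rw [homD_apply, homD_apply, homD_apply, map_sub, map_unit_smul, 𝒩.d_d, ℳ.d_d,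
    Int.negOnePow_sub]
  simp

/-- The cycles of degree `n` in `Hom_A(M, N)`. -/
def homCycles (ℳ : DGModule 𝒜 M) (𝒩 : DGModule 𝒜 N) (n : ℤ) : Submodule R (M →ₗ[R] N) :=
  homDeg ℳ 𝒩 n ⊓ LinearMap.ker (homD ℳ 𝒩 n)

/-- The boundaries (null-homotopic homomorphisms) of degree `n` in `Hom_A(M, N)`. -/
def homBoundaries (ℳ : DGModule 𝒜 M) (𝒩 : DGModule 𝒜 N) (n : ℤ) : Submodule R (M →ₗ[R] N) :=
  (homDeg ℳ 𝒩 (n + 1)).map (homD ℳ 𝒩 (n + 1))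

theorem homBoundaries_le_homCycles (ℳ : DGModule 𝒜 M) (𝒩 : DGModule 𝒜 N) (n : ℤ) :
    homBoundaries ℳ 𝒩 n ≤ homCycles ℳ 𝒩 n := by
  rintro _ ⟨f, hf, rfl⟩
  constructor
  · simpa using homD_mem ℳ 𝒩 hf
  · simpa using homD_homD ℳ 𝒩 (n + 1) f

/-- `Hₙ(Hom_A(M, N))`. -/
abbrev HomHomology (ℳ : DGModule 𝒜 M) (𝒩 : DGModule 𝒜 N) (n : ℤ) : Type _ :=
  ↥(homCycles ℳ 𝒩 n) ⧸ (homBoundaries ℳ 𝒩 n).submoduleOf (homCycles ℳ 𝒩 n)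

end HomComplex

/-- A semi-free resolution `F → M`. -/
structure SemifreeResolution (ℱ : DGModule 𝒜 F) (ℳ : DGModule 𝒜 M) where
  hom : Hom ℱ ℳ
  isSemifree : ℱ.IsSemifree
  isQuasiIso : hom.IsQuasiIso

/-- `Extⁱ_A(M, N) = H₋ᵢ(Hom_A(F, N))`, computed by a semi-free resolution `F → M`. -/
abbrev Ext {ℱ : DGModule 𝒜 F} {ℳ : DGModule 𝒜 M} (_ρ : SemifreeResolution ℱ ℳ)
    (𝒩 : DGModule 𝒜 N) (i : ℤ) : Type _ :=
  HomHomology ℱ 𝒩 (-i)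

section BaseChange

variable {B : Type*} [Ring B] [Algebra R B] {ℬ : DGAlgebra R B}

/-- The `B`-submodule of `B ⊗[R] M` generated by the elements `b f(a) ⊗ m - b ⊗ a m`. By graded
commutativity of `B`, these are (for homogeneous elements) the same as the elements
`a • b ⊗ m - (-1)^(|a||b|) b ⊗ a m` up to sign. -/
def baseChangeRel (f : DGAlgebra.Hom 𝒜 ℬ) (M : Type*) [AddCommGroup M] [Module R M] [Module A M] :
    Submodule B (B ⊗[R] M) :=
  Submodule.span B {x | ∃ (b : B) (a : A) (m : M),
    x = (b * f.toAlgHom a) ⊗ₜ[R] m - b ⊗ₜ[R] (a • m)}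

/-- The underlying module of `B ⊗_A M`. -/
abbrev BaseChangeType (f : DGAlgebra.Hom 𝒜 ℬ) (M : Type*) [AddCommGroup M] [Module R M]
    [Module A M] : Type _ :=
  (B ⊗[R] M) ⧸ baseChangeRel f M

variable (f : DGAlgebra.Hom 𝒜 ℬ) (ℳ : DGModule 𝒜 M)

/-- The quotient map `B ⊗[R] M → B ⊗_A M`. -/
def baseChangeMk : B ⊗[R] M →ₗ[R] BaseChangeType f M :=
  (baseChangeRel f M).mkQ.restrictScalars R

theorem baseChangeMk_surjective : Function.Surjective (baseChangeMk (M := M) f) :=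
  Submodule.mkQ_surjective (baseChangeRel f M)

theorem baseChangeMk_smul (b : B) (x : B ⊗[R] M) :
    baseChangeMk f (b • x) = b • baseChangeMk f x := rfl

theorem baseChangeRel_le_ker {X : Type*} [AddCommGroup X] [Module R X] (g : B ⊗[R] M →ₗ[R] X)
    (hg : ∀ i j k, ∀ b ∈ ℬ.deg i, ∀ a ∈ 𝒜.deg j, ∀ m ∈ ℳ.deg k,
      g ((b * f.toAlgHom a) ⊗ₜ[R] m - b ⊗ₜ[R] (a • m)) = 0) :
    (baseChangeRel f M).restrictScalars R ≤ LinearMap.ker g := by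
  have key : ∀ (b : B) (a : A) (m : M),
      g ((b * f.toAlgHom a) ⊗ₜ[R] m - b ⊗ₜ[R] (a • m)) = 0 := by
    intro b a m
    induction b using DirectSum.Decomposition.inductionOn ℬ.deg with
    | zero => simp
    | add b b' h h' =>
      rw [add_mul, TensorProduct.add_tmul, TensorProduct.add_tmul, add_sub_add_comm, map_add, h, h',
        add_zero]
    | homogeneous b =>
      induction a using DirectSum.Decomposition.inductionOn 𝒜.deg with
      | zero => simp
      | add a a' h h' =>
        rw [map_add, mul_add, TensorProduct.add_tmul, add_smul, TensorProduct.tmul_add,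
          add_sub_add_comm, map_add, h, h', add_zero]
      | homogeneous a =>
        induction m using DirectSum.Decomposition.inductionOn ℳ.deg with
        | zero => simp
        | add m m' h h' =>
          rw [smul_add, TensorProduct.tmul_add, TensorProduct.tmul_add,
            add_sub_add_comm, map_add, h, h', add_zero]
        | homogeneous m => exact hg _ _ _ b b.2 a a.2 m m.2
  intro x hx
  have hx' : x ∈ baseChangeRel f M := hx
  have gen : ∀ b' : B, g (b' • x) = 0 := by
    clear hx
    unfold baseChangeRel at hx'
    induction hx' using Submodule.span_induction with
    | mem x hx =>
      obtain ⟨b, a, m, rfl⟩ := hx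
      intro b'
      rw [smul_sub, TensorProduct.smul_tmul', TensorProduct.smul_tmul', smul_eq_mul, smul_eq_mul,
        ← mul_assoc]
      exact key _ _ _
    | zero => simp
    | add x y _ _ hx hy => intro b'; rw [smul_add, map_add, hx, hy, add_zero]
    | smul c x _ hx => intro b'; rw [smul_smul]; exact hx _
  simpa using gen 1

/-- The map on `B ⊗_A M` induced by a map on `B ⊗[R] M`. -/
def baseChangeLift {X : Type*} [AddCommGroup X] [Module R X] (g : B ⊗[R] M →ₗ[R] X)
    (hg : (baseChangeRel f M).restrictScalars R ≤ LinearMap.ker g) :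
    BaseChangeType f M →ₗ[R] X :=
  ((baseChangeRel f M).restrictScalars R).liftQ g hg ∘ₗ
    (Submodule.Quotient.restrictScalarsEquiv R (baseChangeRel f M)).symm.toLinearMap

theorem baseChangeLift_mk {X : Type*} [AddCommGroup X] [Module R X] (g : B ⊗[R] M →ₗ[R] X)
    (hg : (baseChangeRel f M).restrictScalars R ≤ LinearMap.ker g) (x : B ⊗[R] M) :
    baseChangeLift f g hg (baseChangeMk f x) = g x := rfl

theorem baseChangeMk_rel (b : B) (a : A) (m : M) :
    baseChangeMk f ((b * f.toAlgHom a) ⊗ₜ[R] m - b ⊗ₜ[R] (a • m)) = 0 :=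
  (Submodule.Quotient.mk_eq_zero _).2 (Submodule.subset_span ⟨b, a, m, rfl⟩)

/-- The degree `n` part of `B ⊗_A M`: the image of `⊕_{i+j=n} Bᵢ ⊗ Mⱼ`. -/
def baseChangeDeg (n : ℤ) : Submodule R (BaseChangeType f M) :=
  (tensorDeg ℬ.deg ℳ.deg n).map (baseChangeMk f)

theorem baseChangeRel_le_ker_d : (baseChangeRel f M).restrictScalars R ≤
    LinearMap.ker (baseChangeMk f ∘ₗ tensorD ℬ.deg ℬ.d ℳ.d) := by
  refine baseChangeRel_le_ker f ℳ _ fun i j k b hb a ha m hm => ?_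
  have ha' := f.map_mem j a ha
  have e1 := baseChangeMk_rel f (ℬ.d b) a m
  have e2 := baseChangeMk_rel f b (𝒜.d a) m
  have e3 := baseChangeMk_rel f b a (ℳ.d m)
  rw [map_sub, sub_eq_zero] at e1 e2 e3
  rw [LinearMap.comp_apply, map_sub, map_sub, sub_eq_zero,
    tensorD_tmul ℬ.deg _ _ (SetLike.mul_mem_graded hb ha'), tensorD_tmul ℬ.deg _ _ hb,
    ℬ.leibniz i b hb, ← f.map_d, ℳ.leibniz j a ha, TensorProduct.add_tmul,
    TensorProduct.tmul_add]
  have s1 : ∀ (u : ℤˣ) (x : B) (y : M), (u • x) ⊗ₜ[R] y = u • (x ⊗ₜ[R] y) := by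
    intro u x y
    rcases Int.units_eq_one_or u with h | h <;> simp [h, TensorProduct.neg_tmul]
  have s2 : ∀ (u : ℤˣ) (x : B) (y : M), x ⊗ₜ[R] (u • y) = u • (x ⊗ₜ[R] y) := by
    intro u x y
    rcases Int.units_eq_one_or u with h | h <;> simp [h, TensorProduct.tmul_neg]
  simp only [s1, s2, map_add, map_unit_smul, smul_add, smul_smul, ← Int.negOnePow_add, e1, e2, e3]
  abel

theorem baseChangeRel_le_ker_coaction : (baseChangeRel f M).restrictScalars R ≤
    LinearMap.ker (Finsupp.mapRange.linearMap (baseChangeMk f) ∘ₗ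
      tensorCoaction ℬ.deg ℳ.deg) := by
  refine baseChangeRel_le_ker f ℳ _ fun i j k b hb a ha m hm => ?_
  have h : (b * f.toAlgHom a) ⊗ₜ[R] m - b ⊗ₜ[R] (a • m) ∈ tensorDeg ℬ.deg ℳ.deg (i + j + k) :=
    sub_mem (tmul_mem_tensorDeg (SetLike.mul_mem_graded hb (f.map_mem j a ha)) hm rfl)
      (tmul_mem_tensorDeg hb (ℳ.smul_mem _ _ a ha m hm) (by ring))
  rw [LinearMap.comp_apply, tensorCoaction_of_mem _ _ h, Finsupp.mapRange.linearMap_apply,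
    Finsupp.mapRange_single, baseChangeMk_rel, Finsupp.single_zero]

theorem baseChangeDeg_isInternal : DirectSum.IsInternal (baseChangeDeg f ℳ) := by
  refine isInternal_of_coaction _ ?_
    (baseChangeLift f _ (baseChangeRel_le_ker_coaction f ℳ)) ?_
  · rw [show baseChangeDeg f ℳ = fun n => (tensorDeg ℬ.deg ℳ.deg n).map (baseChangeMk f) from rfl,
      ← Submodule.map_iSup, iSup_tensorDeg, Submodule.map_top, LinearMap.range_eq_top]
    exact baseChangeMk_surjective f
  · rintro n _ ⟨x, hx, rfl⟩
    rw [baseChangeLift_mk, LinearMap.comp_apply, tensorCoaction_of_mem _ _ hx,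
      Finsupp.mapRange.linearMap_apply, Finsupp.mapRange_single]

/-- The differential `b ⊗ m ↦ db ⊗ m + (-1)^|b| b ⊗ dm` of `B ⊗_A M`. -/
noncomputable def baseChangeD : BaseChangeType f M →ₗ[R] BaseChangeType f M :=
  baseChangeLift f _ (baseChangeRel_le_ker_d f ℳ)

theorem baseChangeD_mk (x : B ⊗[R] M) :
    baseChangeD f ℳ (baseChangeMk f x) = baseChangeMk f (tensorD ℬ.deg ℬ.d ℳ.d x) := rfl

/-- The DG `B`-module `B ⊗_A M` for a morphism of DG algebras `A → B`. -/
noncomputable def baseChange : DGModule ℬ (BaseChangeType f M) where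
  deg := baseChangeDeg f ℳ
  isInternal := baseChangeDeg_isInternal f ℳ
  smul_mem := by
    rintro i n b hb _ ⟨x, hx, rfl⟩
    refine ⟨b • x, ?_, rfl⟩
    change x ∈ tensorDeg ℬ.deg ℳ.deg n at hx
    change b • x ∈ tensorDeg ℬ.deg ℳ.deg (i + n)
    unfold tensorDeg at hx
    induction hx using Submodule.span_induction with
    | mem x hx =>
      obtain ⟨p, q, hpq, b', hb', m, hm, rfl⟩ := hx
      rw [TensorProduct.smul_tmul', smul_eq_mul]
      exact tmul_mem_tensorDeg (SetLike.mul_mem_graded hb hb') hm (by omega)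
    | zero => simp
    | add x y _ _ hx hy => rw [smul_add]; exact add_mem hx hy
    | smul r x _ hx => rw [smul_comm]; exact Submodule.smul_mem _ _ hx
  d := baseChangeD f ℳ
  d_mem := by
    rintro n _ ⟨x, hx, rfl⟩
    exact ⟨_, tensorD_mem ℬ.d_mem ℳ.d_mem hx, rfl⟩
  d_d := by
    intro x
    obtain ⟨x, rfl⟩ := baseChangeMk_surjective f x
    rw [baseChangeD_mk, baseChangeD_mk,
      tensorD_tensorD (𝒩 := ℳ.deg) ℬ.d_mem ℬ.d_d ℳ.d_d, map_zero]
  leibniz := by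
    intro i b hb x
    obtain ⟨x, rfl⟩ := baseChangeMk_surjective f x
    rw [← baseChangeMk_smul, baseChangeD_mk, baseChangeD_mk, ← baseChangeMk_smul,
      ← baseChangeMk_smul, ← map_unit_smul, ← map_add]
    congr 1
    induction x using tensor_homogeneous_induction ℬ.deg ℳ.deg with
    | h p q b' hb' m hm =>
      have s : ∀ (u : ℤˣ) (x : B ⊗[R] M), b • (u • x) = u • (b • x) := fun u x =>
        map_unit_smul (DistribSMul.toAddMonoidHom (B ⊗[R] M) b) u x
      have s1 : ∀ (u : ℤˣ) (x : B) (y : M), (u • x) ⊗ₜ[R] y = u • (x ⊗ₜ[R] y) := by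
        intro u x y
        rcases Int.units_eq_one_or u with h | h <;> simp [h, TensorProduct.neg_tmul]
      rw [TensorProduct.smul_tmul', smul_eq_mul, tensorD_tmul _ _ _ (SetLike.mul_mem_graded hb hb'),
        tensorD_tmul _ _ _ hb', ℬ.leibniz i b hb, smul_add, s, TensorProduct.add_tmul, s1,
        TensorProduct.smul_tmul', TensorProduct.smul_tmul', TensorProduct.smul_tmul',
        Int.negOnePow_add, smul_add, smul_smul]
      simp only [smul_eq_mul]
      abel
    | h0 => simp
    | hadd x y hx hy => rw [smul_add, map_add, hx, hy]; simp only [map_add, smul_add]; abel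

/-- `𝒟'` is a lifting of the DG `B`-module `𝒟` along the morphism of DG algebras `A → B`. -/
def IsLifting {D : Type*} [AddCommGroup D] [Module R D] [Module B D] [IsScalarTower R B D]
    (f : DGAlgebra.Hom 𝒜 ℬ) (𝒟 : DGModule ℬ D) (𝒟' : DGModule 𝒜 M) : Prop :=
  Nonempty (Iso 𝒟 (baseChange f 𝒟'))

end BaseChange

end DGModule

universe u v w x

/-! ### Homogeneous components -/

section GradedComponents

variable {R M : Type*} [CommRing R] [AddCommGroup M] [Module R M]
  (ℳ : ℤ → Submodule R M) [DirectSum.Decomposition ℳ]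

/-! Write B = A ⊕ εA with dε = t, and let c be contraction by ε: the odd derivation of B that kills
A and sends ε to 1. It has square zero and anticommutes with the differential. Lifting N to A
amounts to extending c to N, that is, to finding an operator δ of degree -1 with δ(βx) = c(β)x +
(-1)^|β| βδ(x), δ² = 0 and dδ + δd = 0. Given such a δ, the Leibniz rule at ε reads δε + εδ = 1.
Hence N = ker δ ⊕ ε ker δ, and ker δ, which is stable under A and d, is the lifting
(`exists_isLifting`).

A homogeneous basis of N provides a derivation δ along c, with no relation to d. The operator dδ +
δd is a B-linear cycle of degree -2, so the vanishing of Ext² gives dδ + δd = df + fd with f linear,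
and δ - f anticommutes with d. Its square is again a linear cycle of degree -2. Suppose now that δ²
= tⁿw, with w a linear cycle commuting with δ. Then δ - tⁿεw has square zero, but its anticommutator
with d has become -tⁿ⁺¹w, because dε = t. Write w = df + fd and add tⁿ⁺¹f: the anticommutator
vanishes again, and the square is divisible by tⁿ⁺¹ (`IsApproxContraction.exists_improvement`).

The n-th correction is divisible by tⁿ, so the corrections can be summed t-adically: every degree of
N is a finitely generated module over the complete ring R. Since N is free over R, it is t-adically
separated, and both identities hold exactly in the limit
(`exists_isDerivationAlong_mul_self_eq_zero`).

The hypothesis concerns Hom(F, N) for an arbitrary semi-free resolution F → N. As N is itself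
semi-free, the resolution has a section up to homotopy, which carries the vanishing over to Hom(N,
N) (`exists_homotopy_section`, `exists_eq_anticommutator_of_subsingleton_ext`). -/

theorem gradedCoaction_mem (x : M) (j : ℤ) : gradedCoaction ℳ x j ∈ ℳ j := by
  induction x using DirectSum.Decomposition.inductionOn ℳ with
  | zero => simp
  | add x y hx hy => rw [map_add]; exact add_mem hx hy
  | @homogeneous i x =>
    rw [gradedCoaction_of_mem ℳ x.2]
    by_cases h : i = j
    · subst h; simp
    · simp [Finsupp.single_eq_of_ne' h]

theorem gradedCoaction_self {x : M} {j : ℤ} (hx : x ∈ ℳ j) : gradedCoaction ℳ x j = x := by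
  rw [gradedCoaction_of_mem ℳ hx, Finsupp.single_eq_same]

theorem unit_smul_smul {A : Type*} [Ring A] [Module A M] (a : A) (u : ℤˣ) (x : M) :
    (u • a) • x = u • (a • x) :=
  map_unit_smul ((smulAddHom A M).flip x) u a

end GradedComponents

namespace DGModule

variable {R A : Type*} [CommRing R] [Ring A] [Algebra R A] {𝒜 : DGAlgebra R A}
variable {M : Type*} [AddCommGroup M] [Module R M] [Module A M] [IsScalarTower R A M]
variable {N : Type*} [AddCommGroup N] [Module R N] [Module A N] [IsScalarTower R A N]
variable {L : Type*} [AddCommGroup L] [Module R L] [Module A L] [IsScalarTower R A L]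
variable {ℳ : DGModule 𝒜 M} {𝒩 : DGModule 𝒜 N} {ℒ : DGModule 𝒜 L}

/-! ### Skew-linear maps -/

section HomDeg

theorem comp_mem_homDeg {m n : ℤ} {f : N →ₗ[R] L} {g : M →ₗ[R] N} (hf : f ∈ homDeg 𝒩 ℒ m)
    (hg : g ∈ homDeg ℳ 𝒩 n) : f ∘ₗ g ∈ homDeg ℳ ℒ (n + m) := by
  refine ⟨fun j x hx => ?_, fun i a ha x => ?_⟩
  · rw [← add_assoc]; exact hf.1 _ _ (hg.1 _ _ hx)
  · rw [LinearMap.comp_apply, hg.2 i a ha, map_unit_smul, hf.2 i a ha, smul_smul,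
      ← Int.negOnePow_add, ← add_mul]
    rfl

theorem Hom.mem_homDeg (f : Hom ℳ 𝒩) : f.toLinearMap.restrictScalars R ∈ homDeg ℳ 𝒩 0 :=
  ⟨fun j x hx => by simpa using f.map_mem j x hx, fun i a _ x => by simp⟩

theorem id_mem_homDeg (ℳ : DGModule 𝒜 M) : LinearMap.id ∈ homDeg ℳ ℳ 0 :=
  ⟨fun j x hx => by simpa using hx, fun i a _ x => by simp⟩

/-- A skew-linear map that sends a set into a submodule sends its span into that submodule. -/
theorem homDeg_apply_mem_of_mem_span {n : ℤ} {f : M →ₗ[R] N} (hf : f ∈ homDeg ℳ 𝒩 n)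
    {s : Set M} {S : Submodule A N} (h : ∀ x ∈ s, f x ∈ S) {x : M}
    (hx : x ∈ Submodule.span A s) : f x ∈ S := by
  induction hx using Submodule.span_induction with
  | mem x hx => exact h x hx
  | zero => simp
  | add x y _ _ hx hy => rw [map_add]; exact add_mem hx hy
  | smul a x _ hx =>
    induction a using DirectSum.Decomposition.inductionOn 𝒜.deg with
    | zero => simp
    | add a a' h h' => rw [add_smul, map_add]; exact add_mem h h'
    | homogeneous a =>
      rw [hf.2 _ a a.2, Units.smul_def]
      exact zsmul_mem (S.smul_mem _ hx) _

end HomDeg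

/-! ### Homogeneous bases and maps defined on them -/

section HomogeneousBasis

variable {ι : Type*} (b : Module.Basis ι A M) {D : ι → ℤ}

/-- By additivity only homogeneous scalars matter, and multiplication by a scalar of degree p shifts
components by p both in the module and in the algebra. -/
theorem repr_gradedCoaction (hD : ∀ i, b i ∈ ℳ.deg (D i)) (x : M) (j : ℤ) (i : ι) :
    b.repr (gradedCoaction ℳ.deg x j) i = gradedCoaction 𝒜.deg (b.repr x i) (j - D i) := by
  classical
  have hx : x ∈ Submodule.span A (Set.range b) := by rw [b.span_eq]; trivial
  induction hx using Submodule.span_induction generalizing i j with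
  | zero => simp
  | add x y _ _ hx hy => simp [hx, hy]
  | mem x hx =>
    obtain ⟨k, rfl⟩ := hx
    rw [gradedCoaction_of_mem _ (hD k), b.repr_self]
    by_cases hik : k = i
    · subst hik
      rw [Finsupp.single_eq_same, gradedCoaction_of_mem 𝒜.deg (i := 0) SetLike.GradedOne.one_mem]
      by_cases hj : D k = j
      · subst hj; simp
      · rw [Finsupp.single_eq_of_ne' hj, Finsupp.single_eq_of_ne' (by omega)]; simp
    · rw [Finsupp.single_eq_of_ne' hik, map_zero, Finsupp.zero_apply]
      by_cases hj : D k = j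
      · subst hj; simp [Finsupp.single_eq_of_ne' hik]
      · rw [Finsupp.single_eq_of_ne' hj]; simp
  | smul a x _ hx =>
    have key : ∀ p, ∀ a ∈ 𝒜.deg p, ∀ x : M, gradedCoaction ℳ.deg (a • x) j =
        a • gradedCoaction ℳ.deg x (j - p) := by
      intro p a ha x
      induction x using DirectSum.Decomposition.inductionOn ℳ.deg with
      | zero => simp
      | add x y hx hy => simp [hx, hy]
      | @homogeneous q x =>
        rw [gradedCoaction_of_mem _ x.2, gradedCoaction_of_mem _ (ℳ.smul_mem _ _ a ha x x.2)]
        by_cases h : q = j - p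
        · subst h; simp
        · rw [Finsupp.single_eq_of_ne' h, Finsupp.single_eq_of_ne' (by omega), smul_zero]
    have key' : ∀ p, ∀ a ∈ 𝒜.deg p, ∀ x : A, ∀ j, gradedCoaction 𝒜.deg (a * x) j =
        a * gradedCoaction 𝒜.deg x (j - p) := by
      intro p a ha x j
      induction x using DirectSum.Decomposition.inductionOn 𝒜.deg with
      | zero => simp
      | add x y hx hy => simp [hx, hy, mul_add]
      | @homogeneous q x =>
        rw [gradedCoaction_of_mem _ x.2, gradedCoaction_of_mem _ (SetLike.mul_mem_graded ha x.2)]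
        by_cases h : q = j - p
        · subst h; simp
        · rw [Finsupp.single_eq_of_ne' h, Finsupp.single_eq_of_ne' (by omega), mul_zero]
    induction a using DirectSum.Decomposition.inductionOn 𝒜.deg with
    | zero => simp
    | add a a' h h' =>
      simp only [add_smul, map_add, Finsupp.add_apply] at h h' ⊢
      rw [h, h']
    | homogeneous a =>
      rw [key _ a a.2, map_smul, map_smul, Finsupp.smul_apply, Finsupp.smul_apply, smul_eq_mul,
        smul_eq_mul, hx, key' _ a a.2]
      rw [sub_right_comm]

theorem repr_mem_deg (hD : ∀ i, b i ∈ ℳ.deg (D i)) {x : M} {j : ℤ} (hx : x ∈ ℳ.deg j) (i : ι) :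
    b.repr x i ∈ 𝒜.deg (j - D i) := by
  rw [← gradedCoaction_self _ hx, repr_gradedCoaction b hD]
  exact gradedCoaction_mem _ _ _

/-- The algebra lives in non-negative degrees, so basis elements of degree above that of x cannot
occur in x. This makes constructions by recursion on the degree of basis elements possible. -/
theorem repr_eq_zero_of_lt (hD : ∀ i, b i ∈ ℳ.deg (D i)) {x : M} {j : ℤ} (hx : x ∈ ℳ.deg j)
    {i : ι} (hi : j < D i) : b.repr x i = 0 := by
  have h := repr_mem_deg b hD hx i
  rw [𝒜.nonneg _ (by omega)] at h
  simpa using h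

theorem mem_span_basis_of_mem_deg (hD : ∀ i, b i ∈ ℳ.deg (D i)) {x : M} {j : ℤ}
    (hx : x ∈ ℳ.deg j) : x ∈ Submodule.span A (b '' {i | D i ≤ j}) := by
  rw [← b.linearCombination_repr x, Finsupp.linearCombination_apply, Finsupp.sum]
  refine Submodule.sum_mem _ fun i hi => Submodule.smul_mem _ _ (Submodule.subset_span ⟨i, ?_, rfl⟩)
  by_contra h
  exact (Finsupp.mem_support_iff.1 hi) (repr_eq_zero_of_lt b hD hx (not_le.1 h))

/-- The `R`-linear map `a ↦ (-1)^(n|a|) a`. -/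
noncomputable def signPow (𝒜 : DGAlgebra R A) (n : ℤ) : A →ₗ[R] A :=
  DirectSum.toModule R ℤ A (fun i => (n * i).negOnePow • (𝒜.deg i).subtype) ∘ₗ
    (DirectSum.decomposeLinearEquiv 𝒜.deg).toLinearMap

theorem signPow_of_mem (n : ℤ) {i : ℤ} {a : A} (ha : a ∈ 𝒜.deg i) :
    signPow 𝒜 n a = (n * i).negOnePow • a := by
  have h : DirectSum.decomposeLinearEquiv 𝒜.deg a =
      DirectSum.lof R ℤ (fun i => 𝒜.deg i) i ⟨a, ha⟩ := DirectSum.decompose_of_mem 𝒜.deg ha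
  simp only [signPow, LinearMap.comp_apply, LinearEquiv.coe_coe, h, DirectSum.toModule_lof]
  rfl

theorem signPow_mul (n : ℤ) {i : ℤ} {a : A} (ha : a ∈ 𝒜.deg i) (a' : A) :
    signPow 𝒜 n (a * a') = (n * i).negOnePow • (a * signPow 𝒜 n a') := by
  induction a' using DirectSum.Decomposition.inductionOn 𝒜.deg with
  | zero => simp
  | add x y hx hy => simp only [mul_add, map_add, hx, hy, smul_add]
  | homogeneous x =>
    rw [signPow_of_mem n x.2, signPow_of_mem n (SetLike.mul_mem_graded ha x.2), mul_unit_smul,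
      smul_smul, ← Int.negOnePow_add, ← mul_add]

/-- The linear map sending `∑ aᵢ bᵢ` to `∑ c(aᵢ) yᵢ`, for a basis `b`. -/
noncomputable def basisMap (c : A →ₗ[R] A) (y : ι → N) : M →ₗ[R] N :=
  Finsupp.lsum R (fun i => ((LinearMap.toSpanSingleton A N (y i)).restrictScalars R) ∘ₗ c) ∘ₗ
    (b.repr.toLinearMap.restrictScalars R)

theorem basisMap_apply (c : A →ₗ[R] A) (y : ι → N) (x : M) :
    basisMap b c y x = (b.repr x).sum fun i a => c a • y i := by
  simp only [basisMap, LinearMap.comp_apply, Finsupp.lsum_apply]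
  rfl

theorem basisMap_smul_basis (c : A →ₗ[R] A) (y : ι → N) (a : A) (i : ι) :
    basisMap b c y (a • b i) = c a • y i := by
  rw [basisMap_apply, map_smul, b.repr_self, Finsupp.smul_single, Finsupp.sum_single_index (by simp)]
  simp

omit [Module R M] [IsScalarTower R A M] in
theorem basis_induction {P : M → Prop} (h0 : P 0) (hadd : ∀ x y, P x → P y → P (x + y))
    (hs : ∀ i k, ∀ a ∈ 𝒜.deg k, P (a • b i)) (x : M) : P x := by
  rw [← b.linearCombination_repr x, Finsupp.linearCombination_apply, Finsupp.sum]
  refine Finset.sum_induction _ P hadd h0 fun i _ => ?_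
  generalize b.repr x i = a
  induction a using DirectSum.Decomposition.inductionOn 𝒜.deg with
  | zero => simpa using h0
  | add a a' h h' => rw [add_smul]; exact hadd _ _ h h'
  | homogeneous a => exact hs _ _ a a.2

/-- The skew-linear map of degree `n` with given values on a basis. -/
noncomputable def skewExtend (n : ℤ) (y : ι → N) : M →ₗ[R] N := basisMap b (signPow 𝒜 n) y

theorem basisMap_mem_deg (hD : ∀ i, b i ∈ ℳ.deg (D i)) {p n : ℤ} {c : A →ₗ[R] A}
    (hc : ∀ i, ∀ a ∈ 𝒜.deg i, c a ∈ 𝒜.deg (i + p)) {y : ι → N}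
    (hy : ∀ i, y i ∈ 𝒩.deg (D i + n)) {j : ℤ} {x : M} (hx : x ∈ ℳ.deg j) :
    basisMap b c y x ∈ 𝒩.deg (j + (p + n)) := by
  rw [basisMap_apply]
  refine Submodule.sum_mem _ fun i _ => ?_
  have := 𝒩.smul_mem _ _ _ (hc _ _ (repr_mem_deg b hD hx i)) _ (hy i)
  rwa [show j - D i + p + (D i + n) = j + (p + n) by ring] at this

theorem skewExtend_basis (n : ℤ) (y : ι → N) (i : ι) :
    skewExtend (𝒜 := 𝒜) b n y (b i) = y i := by
  have h := basisMap_smul_basis b (signPow 𝒜 n) y 1 i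
  rw [one_smul, signPow_of_mem (i := 0) n SetLike.GradedOne.one_mem] at h
  simpa [skewExtend] using h

theorem skewExtend_mem (hD : ∀ i, b i ∈ ℳ.deg (D i)) {n : ℤ} {y : ι → N}
    (hy : ∀ i, y i ∈ 𝒩.deg (D i + n)) : skewExtend (𝒜 := 𝒜) b n y ∈ homDeg ℳ 𝒩 n := by
  refine ⟨fun j x hx => ?_, fun i a ha x => ?_⟩
  · rw [← zero_add n]
    refine basisMap_mem_deg b hD (p := 0) (fun i a ha => ?_) hy hx
    rw [signPow_of_mem _ ha, add_zero]
    exact unit_smul_mem _ _ ha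
  · induction x using basis_induction (𝒜 := 𝒜) b with
    | h0 => simp
    | hadd x y hx hy => simp only [smul_add, map_add, hx, hy]
    | hs k q a' ha' =>
      rw [smul_smul, skewExtend, basisMap_smul_basis, basisMap_smul_basis, signPow_mul n ha,
        unit_smul_smul, mul_smul]

end HomogeneousBasis

end DGModule

/-- Recursive choice along a rank function, for a condition `Q i T` that depends only on `T i` and
on the values of `T` at indices of smaller rank. -/
theorem exists_forall_of_rank_recursion {ι X : Type*} [Zero X] (r : ι → ℕ) (Q : ι → (ι → X) → Prop)
    (hloc : ∀ i T T', T i = T' i → (∀ j, r j < r i → T j = T' j) → Q i T → Q i T')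
    (hstep : ∀ i T, (∀ j, r j < r i → Q j T) → (∀ j, ¬ r j < r i → T j = 0) →
      ∃ T', (∀ j, r j < r i → T' j = T j) ∧ Q i T') :
    ∃ T, ∀ i, Q i T := by
  classical
  let G : (i : ι) → ((j : ι) → r j < r i → X) → X := fun i ih =>
    let T₀ : ι → X := fun j => if h : r j < r i then ih j h else 0
    -- The recursion carries values only, not the proof that they satisfy `Q`, so a junk value is
    -- needed when no extension exists. The induction below shows that this case never arises.
    if h : ∃ T', (∀ j, r j < r i → T' j = T₀ j) ∧ Q i T' then h.choose i else 0
  let T : ι → X := (measure r).wf.fix G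
  have hT : ∀ i, T i = G i (fun j _ => T j) := fun i => (measure r).wf.fix_eq G i
  refine ⟨T, fun i => ?_⟩
  induction h : r i using Nat.strong_induction_on generalizing i with
  | _ n ih =>
    subst h
    let T₀ : ι → X := fun j => if r j < r i then T j else 0
    have hT₀ : ∀ j, r j < r i → T₀ j = T j := fun j hj => if_pos hj
    have hex : ∃ T', (∀ j, r j < r i → T' j = T₀ j) ∧ Q i T' := by
      refine hstep i T₀ (fun j hj => ?_) fun j hj => if_neg hj
      exact hloc j T T₀ (hT₀ j hj).symm (fun k hk => (hT₀ k (hk.trans hj)).symm) (ih _ hj j rfl)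
    have hTi : T i = hex.choose i := by
      rw [hT]
      exact dif_pos hex
    exact hloc i _ T hTi.symm (fun j hj => (hex.choose_spec.1 j hj).trans (hT₀ j hj))
      hex.choose_spec.2

/-! ### Semi-free modules, quasi-isomorphisms and Ext -/

namespace DGModule

variable {R A : Type*} [CommRing R] [Ring A] [Algebra R A] {𝒜 : DGAlgebra R A}
variable {N : Type*} [AddCommGroup N] [Module R N] [Module A N] [IsScalarTower R A N]
variable {F : Type*} [AddCommGroup F] [Module R F] [Module A F] [IsScalarTower R A F]
variable {ℱ : DGModule 𝒜 F} {𝒩 : DGModule 𝒜 N}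

/-- The mapping cone of a quasi-isomorphism is acyclic. -/
theorem Hom.IsQuasiIso.exists_cone_preimage {ρ : Hom ℱ 𝒩} (hρ : ρ.IsQuasiIso) {i : ℤ} {a : F}
    (ha : a ∈ ℱ.deg (i - 1)) (hda : ℱ.d a = 0) {β : N} (hβ : β ∈ 𝒩.deg i)
    (h : ρ.toLinearMap a = 𝒩.d β) :
    ∃ y ∈ ℱ.deg i, ∃ z ∈ 𝒩.deg (i + 1), ℱ.d y = a ∧ ρ.toLinearMap y = β + 𝒩.d z := by
  -- The class of a dies in the homology of N, being the boundary of β there; injectivity on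
  -- homology makes a itself a boundary.
  obtain ⟨y₀, hy₀, hdy₀⟩ : ∃ y ∈ ℱ.deg i, ℱ.d y = a := by
    have h0 : ρ.homologyMap (i - 1) (Submodule.Quotient.mk ⟨a, ha, hda⟩) = 0 := by
      refine (Submodule.Quotient.mk_eq_zero _).2 ?_
      exact ⟨β, by rwa [sub_add_cancel], h.symm⟩
    have h1 := (hρ (i - 1)).1 (h0.trans (map_zero _).symm)
    obtain ⟨y, hy, hya⟩ := (Submodule.Quotient.mk_eq_zero _).1 h1
    exact ⟨y, by simpa using hy, hya⟩
  -- The defect of y₀ is a cycle; surjectivity on homology matches it with a cycle c of F up to a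
  -- boundary, and y₀ - c is the corrected choice.
  have hc : ρ.toLinearMap y₀ - β ∈ 𝒩.cycles i := by
    refine ⟨sub_mem (ρ.map_mem _ _ hy₀) hβ, ?_⟩
    change 𝒩.d (ρ.toLinearMap y₀ - β) = 0
    rw [map_sub, ← ρ.map_d, hdy₀, h, sub_self]
  obtain ⟨c, hc'⟩ := (hρ i).2 (Submodule.Quotient.mk ⟨_, hc⟩)
  obtain ⟨⟨c, hcd, hcz⟩, rfl⟩ := Submodule.Quotient.mk_surjective _ c
  obtain ⟨z, hz, hzc⟩ := (Submodule.Quotient.eq _).1 hc'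
  replace hzc : 𝒩.d z = ρ.toLinearMap c - (ρ.toLinearMap y₀ - β) := hzc
  refine ⟨y₀ - c, sub_mem hy₀ hcd, -z, neg_mem hz, ?_, ?_⟩
  · rw [map_sub, hdy₀, LinearMap.mem_ker.1 hcz, sub_zero]
  · rw [map_sub, map_neg, hzc]; abel

/-- Supplies the locality required by the rank recursion: d(bᵢ) involves only basis elements of
degree smaller than that of bᵢ. -/
theorem skewExtend_congr {ι : Type*} (b : Module.Basis ι A N) {D : ι → ℤ}
    (hD : ∀ i, b i ∈ 𝒩.deg (D i)) (n : ℤ) {y y' : ι → F} {j : ℤ} (h : ∀ i, D i ≤ j → y i = y' i)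
    {x : N} (hx : x ∈ 𝒩.deg j) :
    skewExtend (𝒜 := 𝒜) b n y x = skewExtend (𝒜 := 𝒜) b n y' x := by
  rw [skewExtend, skewExtend, basisMap_apply, basisMap_apply]
  refine Finsupp.sum_congr fun i hi => ?_
  rw [h i]
  by_contra hlt
  exact (Finsupp.mem_support_iff.1 hi) (repr_eq_zero_of_lt b hD hx (not_le.1 hlt))

/-- A quasi-isomorphism to a semi-free DG module has a right inverse up to homotopy. -/
theorem Hom.IsQuasiIso.exists_homotopy_section {ρ : Hom ℱ 𝒩} (hρ : ρ.IsQuasiIso) {ι : Type*}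
    (b : Module.Basis ι A N) {D : ι → ℤ} (hD : ∀ i, b i ∈ 𝒩.deg (D i)) {n₀ : ℤ}
    (hn₀ : ∀ i, n₀ ≤ D i) :
    ∃ σ ∈ homDeg 𝒩 ℱ 0, ∃ s ∈ homDeg 𝒩 𝒩 1, (∀ x, ℱ.d (σ x) = σ (𝒩.d x)) ∧
      ∀ x, ρ.toLinearMap (σ x) - x = 𝒩.d (s x) + s (𝒩.d x) := by
  let σ : (ι → F × N) → N →ₗ[R] F := fun T => skewExtend (𝒜 := 𝒜) b 0 fun i => (T i).1
  let s : (ι → F × N) → N →ₗ[R] N := fun T => skewExtend (𝒜 := 𝒜) b 1 fun i => (T i).2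
  let r : ι → ℕ := fun i => (D i - n₀).toNat
  have hr : ∀ {i j}, r j < r i ↔ D j < D i := by
    intro i j
    have := hn₀ i
    have := hn₀ j
    simp only [r]; omega
  -- A pair records the values at a basis element of the section σ and of the homotopy s. `Q₁` fixes
  -- their degrees; `Q₂` is the chain map equation together with the homotopy equation.
  let Q₁ : ι → (ι → F × N) → Prop := fun i T => (T i).1 ∈ ℱ.deg (D i) ∧ (T i).2 ∈ 𝒩.deg (D i + 1)
  let Q₂ : ι → (ι → F × N) → Prop := fun i T => ℱ.d (T i).1 = σ T (𝒩.d (b i)) ∧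
    ρ.toLinearMap (T i).1 - b i = 𝒩.d (T i).2 + s T (𝒩.d (b i))
  have hσ : ∀ T, (∀ i, Q₁ i T) → σ T ∈ homDeg 𝒩 ℱ 0 := fun T hT =>
    skewExtend_mem b hD fun i => by simpa using (hT i).1
  have hs : ∀ T, (∀ i, Q₁ i T) → s T ∈ homDeg 𝒩 𝒩 1 := fun T hT =>
    skewExtend_mem b hD fun i => (hT i).2
  -- The defects of both equations are skew-linear, so they vanish in degree j as soon as they
  -- vanish on the basis elements of degree at most j.
  have hspan : ∀ T, (∀ i, Q₁ i T) → ∀ j, (∀ i, D i ≤ j → Q₂ i T) → ∀ x ∈ 𝒩.deg j,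
      ℱ.d (σ T x) = σ T (𝒩.d x) ∧ ρ.toLinearMap (σ T x) - x = 𝒩.d (s T x) + s T (𝒩.d x) := by
    intro T h1 j h2 x hx
    have hx' := mem_span_basis_of_mem_deg b hD hx
    have e1 : homD 𝒩 ℱ 0 (σ T) x ∈ (⊥ : Submodule A F) := by
      refine homDeg_apply_mem_of_mem_span (homD_mem 𝒩 ℱ (hσ T h1)) ?_ hx'
      rintro _ ⟨i, hi, rfl⟩
      have := (h2 i hi).1
      rw [homD_apply, show σ T (b i) = (T i).1 from skewExtend_basis b 0 _ i, this]
      simp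
    have e2 : ((ρ.toLinearMap.restrictScalars R) ∘ₗ σ T - LinearMap.id - homD 𝒩 𝒩 1 (s T) :
        N →ₗ[R] N) x ∈ (⊥ : Submodule A N) := by
      refine homDeg_apply_mem_of_mem_span (ℳ := 𝒩) (𝒩 := 𝒩) (n := 0) ?_ ?_ hx'
      · exact sub_mem (sub_mem (comp_mem_homDeg ρ.mem_homDeg (hσ T h1)) (id_mem_homDeg 𝒩))
          (homD_mem 𝒩 𝒩 (hs T h1))
      · rintro _ ⟨i, hi, rfl⟩
        have h := (h2 i hi).2
        have h3 : σ T (b i) = (T i).1 := skewExtend_basis b 0 _ i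
        have h4 : s T (b i) = (T i).2 := skewExtend_basis b 1 _ i
        simp only [LinearMap.sub_apply, LinearMap.comp_apply, LinearMap.restrictScalars_apply,
          LinearMap.id_apply, homD_apply, h3, h4, h]
        simp
    constructor
    · rw [Submodule.mem_bot, homD_apply, sub_eq_zero] at e1
      simpa using e1
    · rw [Submodule.mem_bot, LinearMap.sub_apply, sub_eq_zero, homD_apply] at e2
      simpa using e2
  obtain ⟨T, hT⟩ := exists_forall_of_rank_recursion r (fun i T => Q₁ i T ∧ Q₂ i T) (by
    rintro i T T' hi hlt ⟨h1, h2⟩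
    have hσ' : σ T (𝒩.d (b i)) = σ T' (𝒩.d (b i)) :=
      skewExtend_congr b hD 0 (fun j hj => by rw [hlt j (hr.2 (by omega))]) (𝒩.d_mem _ _ (hD i))
    have hs' : s T (𝒩.d (b i)) = s T' (𝒩.d (b i)) :=
      skewExtend_congr b hD 1 (fun j hj => by rw [hlt j (hr.2 (by omega))]) (𝒩.d_mem _ _ (hD i))
    simp only [Q₁, Q₂] at h1 h2 ⊢
    rw [← hi, ← hσ', ← hs']
    exact ⟨h1, h2⟩) (by
    classical
    intro i T hlt hge
    -- The value 0 at indices not yet treated lies in every degree, so σ and s are already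
    -- homogeneous skew-linear maps.
    have h1 : ∀ j, Q₁ j T := by
      intro j
      by_cases hj : r j < r i
      · exact (hlt j hj).1
      · simp [Q₁, hge j hj]
    have h2 : ∀ j, D j ≤ D i - 1 → Q₂ j T := fun j hj => (hlt j (hr.2 (by omega))).2
    have hdb := 𝒩.d_mem _ _ (hD i)
    obtain ⟨e1, e2⟩ := hspan T h1 _ h2 _ hdb
    rw [𝒩.d_d, map_zero] at e1 e2
    -- The values needed at bᵢ satisfy dy = σ(dbᵢ) and ρ(y) = bᵢ + s(dbᵢ) + dz. The compatibility
    -- condition for solving this is the homotopy equation at dbᵢ, known from smaller degrees.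
    obtain ⟨y, hy, z, hz, hdy, hρy⟩ := hρ.exists_cone_preimage (i := D i)
      (by simpa using (hσ T h1).1 _ _ hdb) e1
      (β := b i + s T (𝒩.d (b i))) (add_mem (hD i) (by simpa using (hs T h1).1 _ _ hdb))
      (by rw [map_add]; rw [add_zero, sub_eq_iff_eq_add'] at e2; exact e2)
    refine ⟨Function.update T i (y, z), fun j hj => ?_, ?_⟩
    · rw [Function.update_of_ne]
      rintro rfl
      exact lt_irrefl _ hj
    · have hupd : ∀ j, D j ≤ D i - 1 → Function.update T i (y, z) j = T j := fun j hj => by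
        rw [Function.update_of_ne]
        rintro rfl
        omega
      have hσ' : σ (Function.update T i (y, z)) (𝒩.d (b i)) = σ T (𝒩.d (b i)) :=
        skewExtend_congr b hD 0 (fun j hj => by rw [hupd j hj]) hdb
      have hs' : s (Function.update T i (y, z)) (𝒩.d (b i)) = s T (𝒩.d (b i)) :=
        skewExtend_congr b hD 1 (fun j hj => by rw [hupd j hj]) hdb
      simp only [Q₁, Q₂, hσ', hs', Function.update_self]
      refine ⟨⟨hy, hz⟩, hdy, ?_⟩
      rw [hρy]; abel)
  have h1 : ∀ i, Q₁ i T := fun i => (hT i).1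
  have h2 : ∀ x, ℱ.d (σ T x) = σ T (𝒩.d x) ∧
      ρ.toLinearMap (σ T x) - x = 𝒩.d (s T x) + s T (𝒩.d x) := by
    intro x
    induction x using DirectSum.Decomposition.inductionOn 𝒩.deg with
    | zero => simp
    | homogeneous x => exact hspan T h1 _ (fun i _ => (hT i).2) _ x.2
    | add x y hx hy =>
      simp only [map_add, hx.1, hy.1, true_and]
      rw [add_sub_add_comm, hx.2, hy.2]; abel
  exact ⟨σ T, hσ T h1, s T, hs T h1, fun x => (h2 x).1, fun x => (h2 x).2⟩

/-- If `Ext²(N, N) = 0`, then every cycle of degree `-2` in `Hom(N, N)` is a boundary. -/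
theorem exists_eq_anticommutator_of_subsingleton_ext (ρ : SemifreeResolution ℱ 𝒩)
    (hExt : Subsingleton (Ext ρ 𝒩 2)) {ι : Type*}
    (b : Module.Basis ι A N) {D : ι → ℤ} (hD : ∀ i, b i ∈ 𝒩.deg (D i)) {n₀ : ℤ}
    (hn₀ : ∀ i, n₀ ≤ D i) {w : Module.End R N} (hw : w ∈ homDeg 𝒩 𝒩 (-2))
    (hdw : 𝒩.d * w = w * 𝒩.d) :
    ∃ f : Module.End R N, f ∈ homDeg 𝒩 𝒩 (-1) ∧ w = 𝒩.d * f + f * 𝒩.d := by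
  obtain ⟨σ, hσ, s, hs, hdσ, hds⟩ := ρ.isQuasiIso.exists_homotopy_section b hD hn₀
  -- The composite wρ is a cycle in Hom(F, N), hence the boundary of some h.
  have hcyc : w ∘ₗ (ρ.hom.toLinearMap.restrictScalars R) ∈ homCycles ℱ 𝒩 (-2) := by
    refine ⟨by simpa using comp_mem_homDeg hw ρ.hom.mem_homDeg, ?_⟩
    change homD ℱ 𝒩 (-2) _ = 0
    ext x
    rw [homD_apply]
    have := LinearMap.congr_fun hdw (ρ.hom.toLinearMap x)
    simp only [Module.End.mul_apply] at this
    rw [Int.negOnePow_even (-2) ⟨-1, rfl⟩, one_smul]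
    simp [this, ρ.hom.map_d]
  have h0 : (Submodule.Quotient.mk ⟨_, hcyc⟩ : Ext ρ 𝒩 2) = 0 := Subsingleton.elim _ _
  obtain ⟨h, hh, hhw⟩ := (Submodule.Quotient.mk_eq_zero _).1 h0
  have hh1 : h ∈ homDeg ℱ 𝒩 (-1) := hh
  have hhw' : ∀ x, w (ρ.hom.toLinearMap x) = 𝒩.d (h x) + h (ℱ.d x) := by
    intro x
    have := LinearMap.congr_fun hhw x
    change homD ℱ 𝒩 (-2 + 1) h x = w (ρ.hom.toLinearMap x) at this
    rw [← this, homD_apply]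
    simp
  -- From ρσ - 1 = ds + sd one gets w = wρσ - w(ds + sd); the first term is the boundary of hσ, the
  -- second that of ws, since w commutes with d.
  refine ⟨h ∘ₗ σ - w ∘ₗ s, sub_mem (comp_mem_homDeg hh1 hσ) (comp_mem_homDeg hw hs), ?_⟩
  ext x
  have e1 := hhw' (σ x)
  have e2 := congrArg w (hds x)
  have e3 := LinearMap.congr_fun hdw (s x)
  simp only [Module.End.mul_apply] at e3
  rw [map_sub, map_add, e1, hdσ, ← e3, sub_eq_iff_eq_add] at e2
  simp only [LinearMap.add_apply, Module.End.mul_apply, LinearMap.sub_apply, LinearMap.comp_apply,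
    map_sub]
  rw [eq_comm, ← sub_eq_iff_eq_add'] at e2
  rw [← e2]; abel

end DGModule

/-! ### The Koszul extension and its contraction -/

namespace DGAlgebra

variable {R A : Type*} [CommRing R] [Ring A] [Algebra R A]

/-- The underlying graded algebra of a DG algebra, with zero differential. -/
noncomputable def zeroDifferential (𝒜 : DGAlgebra R A) : DGAlgebra R A where
  deg := 𝒜.deg
  graded := 𝒜.graded
  d := 0
  d_mem := by simp
  d_d := by simp
  leibniz := by simp
  graded_comm := 𝒜.graded_comm
  sq_zero := 𝒜.sq_zero
  nonneg := 𝒜.nonneg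

variable (t : R) (𝒜 : DGAlgebra R A)

/-- The generator `ε` of `K(t) ⊗ A`. -/
noncomputable def koszulEps : (koszul t).TensorType 𝒜 :=
  GradedTensorProduct.tmul R (DualNumber.eps : DualNumber R) (1 : A)

/-- The inclusion `a ↦ 1 ⊗ a` of `A` in `K(t) ⊗ A`. -/
noncomputable abbrev koszulIncl : A →ₐ[R] (koszul t).TensorType 𝒜 :=
  ((koszul t).tensorInclude 𝒜).toAlgHom

/-- The contraction `ε ⊗ a ↦ 1 ⊗ a`, `1 ⊗ a ↦ 0` on `K(t) ⊗ A`. -/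
noncomputable def contraction : (koszul t).TensorType 𝒜 →ₗ[R] (koszul t).TensorType 𝒜 :=
  -- The graded algebra underlying K(t) does not depend on t. The contraction is thus the
  -- differential of K(1) ⊗ A, with A given zero differential, so its degree, Leibniz rule and
  -- vanishing square are axioms of that DG algebra.
  tensorDiff (koszul (1 : R)) 𝒜.zeroDifferential

theorem koszulIncl_apply (a : A) : koszulIncl t 𝒜 a = GradedTensorProduct.tmul R 1 a := rfl

theorem one_mem_koszulDeg : (1 : DualNumber R) ∈ (koszul t).deg 0 :=
  ⟨fun h => absurd rfl h, fun _ => by simp⟩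

theorem eps_mem_koszulDeg : (DualNumber.eps : DualNumber R) ∈ (koszul t).deg 1 :=
  ⟨fun _ => by simp, fun h => absurd rfl h⟩

theorem koszulEps_mem : koszulEps t 𝒜 ∈ ((koszul t).tensor 𝒜).deg 1 :=
  tmul_mem_tensorGrading _ _ (eps_mem_koszulDeg t) SetLike.GradedOne.one_mem (add_zero 1)

theorem d_koszulEps : ((koszul t).tensor 𝒜).d (koszulEps t 𝒜) = t • 1 := by
  refine (tensorDiff_tmul (koszul t) 𝒜 (eps_mem_koszulDeg t) 1).trans ?_
  rw [𝒜.d_one, show (koszul t).d DualNumber.eps = t • 1 by ext <;> simp [koszul]]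
  simp only [GradedTensorProduct.tmul, TensorProduct.tmul_zero, map_zero, smul_zero, add_zero]
  rfl

theorem contraction_tmul {i : ℤ} {κ : DualNumber R} (hκ : κ ∈ koszulDeg R i) (a : A) :
    contraction t 𝒜 (GradedTensorProduct.tmul R κ a) =
      GradedTensorProduct.tmul R (TrivSqZeroExt.inl κ.snd : DualNumber R) a := by
  refine (tensorDiff_tmul (koszul (1 : R)) 𝒜.zeroDifferential hκ a).trans ?_
  rw [show (koszul (1 : R)).d κ = TrivSqZeroExt.inl κ.snd by simp [koszul]]
  simp [zeroDifferential, GradedTensorProduct.tmul]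
  rfl

theorem contraction_mem {i : ℤ} {x : (koszul t).TensorType 𝒜}
    (hx : x ∈ ((koszul t).tensor 𝒜).deg i) :
    contraction t 𝒜 x ∈ ((koszul t).tensor 𝒜).deg (i - 1) :=
  ((koszul (1 : R)).tensor 𝒜.zeroDifferential).d_mem i x hx

theorem contraction_contraction (x : (koszul t).TensorType 𝒜) :
    contraction t 𝒜 (contraction t 𝒜 x) = 0 :=
  ((koszul (1 : R)).tensor 𝒜.zeroDifferential).d_d x

theorem contraction_mul {i : ℤ} {x : (koszul t).TensorType 𝒜}
    (hx : x ∈ ((koszul t).tensor 𝒜).deg i) (y : (koszul t).TensorType 𝒜) :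
    contraction t 𝒜 (x * y) = contraction t 𝒜 x * y + i.negOnePow • (x * contraction t 𝒜 y) :=
  ((koszul (1 : R)).tensor 𝒜.zeroDifferential).leibniz i x hx y

theorem contraction_koszulEps : contraction t 𝒜 (koszulEps t 𝒜) = 1 := by
  rw [koszulEps, contraction_tmul t 𝒜 (eps_mem_koszulDeg t)]
  simp only [DualNumber.snd_eps]
  rfl

theorem contraction_koszulIncl (a : A) : contraction t 𝒜 (koszulIncl t 𝒜 a) = 0 := by
  rw [koszulIncl_apply, contraction_tmul t 𝒜 (one_mem_koszulDeg t)]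
  simp [GradedTensorProduct.tmul]

/-- On the Koszul factor both composites vanish, since dκ and cκ are multiples of 1. What remains
are the two terms with the differential of A, whose signs are opposite because c lowers the Koszul
degree by one. -/
theorem contraction_d_add_d_contraction (x : (koszul t).TensorType 𝒜) :
    contraction t 𝒜 (((koszul t).tensor 𝒜).d x) + ((koszul t).tensor 𝒜).d (contraction t 𝒜 x) =
      0 := by
  induction x using tensor_induction with
  | h i j κ hκ a ha =>
    change contraction t 𝒜 (tensorDiff _ _ _) + tensorDiff (koszul t) 𝒜 _ = 0
    rw [contraction_tmul t 𝒜 hκ, tensorDiff_tmul _ _ hκ, map_add, map_unit_smul,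
      contraction_tmul t 𝒜 hκ, contraction_tmul t 𝒜 ((koszul t).d_mem _ _ hκ),
      tensorDiff_tmul (koszul t) 𝒜 (i := i - 1)]
    · have e1 : ((koszul t).d κ).snd = 0 := by simp [koszul]
      have e2 : (koszul t).d (TrivSqZeroExt.inl κ.snd) = 0 := by simp [koszul]
      rw [e1, e2, Int.negOnePow_sub]
      simp [GradedTensorProduct.tmul]
    · obtain ⟨h0, h1⟩ := hκ
      refine ⟨fun h => ?_, fun _ => by simp⟩
      simp [h1 (by omega)]
  | h0 => simp
  | hadd x y hx hy =>
    simp only [map_add]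
    rw [add_add_add_comm, hx, hy, add_zero]

/-- The augmentation `ε ⊗ a ↦ 0`, `1 ⊗ a ↦ a`. -/
noncomputable def koszulAug : (koszul t).TensorType 𝒜 →ₗ[R] A :=
  (TensorProduct.lid R A).toLinearMap ∘ₗ
    TensorProduct.map (TrivSqZeroExt.fstHom R R R).toLinearMap LinearMap.id ∘ₗ
      (GradedTensorProduct.of R (koszul t).deg 𝒜.deg).symm.toLinearMap

theorem koszulAug_tmul (κ : DualNumber R) (a : A) :
    koszulAug t 𝒜 (GradedTensorProduct.tmul R κ a) = κ.fst • a := rfl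

theorem koszulAug_koszulIncl (a : A) : koszulAug t 𝒜 (koszulIncl t 𝒜 a) = a := by
  rw [koszulIncl_apply, koszulAug_tmul, TrivSqZeroExt.fst_one, one_smul]

theorem koszulEps_mul_tmul {i : ℤ} {κ : DualNumber R} (hκ : κ ∈ (koszul t).deg i) (a : A) :
    koszulEps t 𝒜 * GradedTensorProduct.tmul R κ a =
      GradedTensorProduct.tmul R (DualNumber.eps * κ) a := by
  rw [koszulEps, tensor_mul (koszul t) 𝒜 (j := 0) _ SetLike.GradedOne.one_mem hκ]
  simp

theorem koszulAug_koszulEps_mul (x : (koszul t).TensorType 𝒜) :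
    koszulAug t 𝒜 (koszulEps t 𝒜 * x) = 0 := by
  induction x using tensor_induction with
  | h i j κ hκ a ha => rw [koszulEps_mul_tmul t 𝒜 hκ, koszulAug_tmul]; simp
  | h0 => simp
  | hadd x y hx hy => rw [mul_add, map_add, hx, hy, add_zero]

theorem tmul_eq_koszulIncl_add (κ : DualNumber R) (a : A) :
    (GradedTensorProduct.tmul R κ a : (koszul t).TensorType 𝒜) =
      koszulIncl t 𝒜 (κ.fst • a) + koszulEps t 𝒜 * koszulIncl t 𝒜 (κ.snd • a) := by
  rw [koszulIncl_apply, koszulIncl_apply, koszulEps_mul_tmul t 𝒜 (one_mem_koszulDeg t)]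
  have h : κ = κ.fst • 1 + κ.snd • DualNumber.eps := by ext <;> simp
  conv_lhs => rw [h]
  simp only [GradedTensorProduct.tmul, TensorProduct.add_tmul, TensorProduct.smul_tmul, map_add,
    mul_one]

theorem exists_eq_koszulIncl_add (x : (koszul t).TensorType 𝒜) :
    ∃ a, x = koszulIncl t 𝒜 (koszulAug t 𝒜 x) + koszulEps t 𝒜 * koszulIncl t 𝒜 a := by
  induction x using tensor_induction with
  | h i j κ hκ a ha => exact ⟨κ.snd • a, tmul_eq_koszulIncl_add t 𝒜 κ a⟩
  | h0 => exact ⟨0, by simp⟩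
  | hadd x y hx hy =>
    obtain ⟨a, ha⟩ := hx
    obtain ⟨a', ha'⟩ := hy
    refine ⟨a + a', ?_⟩
    conv_lhs => rw [ha, ha']
    simp only [map_add, mul_add]
    abel

/-- Degree n of B is the sum of the images of Aₙ and εAₙ₋₁. Finiteness over R is what allows t-adic
sums to be formed in each degree of N. -/
theorem koszulTensor_deg_fg (hA : ∀ i, Module.Finite R (𝒜.deg i)) (n : ℤ) :
    (((koszul t).tensor 𝒜).deg n).FG := by
  have h : ((koszul t).tensor 𝒜).deg n = (𝒜.deg n).map (koszulIncl t 𝒜).toLinearMap ⊔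
      (𝒜.deg (n - 1)).map
        (LinearMap.mulLeft R (koszulEps t 𝒜) ∘ₗ (koszulIncl t 𝒜).toLinearMap) := by
    refine le_antisymm (fun x hx => ?_) (sup_le ?_ ?_)
    · induction hx using tensorGrading_induction with
      | h i j hij κ hκ a ha =>
        rw [tmul_eq_koszulIncl_add]
        refine add_mem (Submodule.mem_sup_left ⟨_, ?_, rfl⟩) (Submodule.mem_sup_right ⟨_, ?_, rfl⟩)
        · by_cases h0 : i = 0
          · subst h0
            rw [← hij, zero_add]
            exact Submodule.smul_mem _ _ ha
          · rw [hκ.1 h0, zero_smul]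
            exact zero_mem _
        · by_cases h0 : i = 1
          · subst h0
            rw [← hij, add_sub_cancel_left]
            exact Submodule.smul_mem _ _ ha
          · rw [hκ.2 h0, zero_smul]
            exact zero_mem _
      | h0 => exact zero_mem _
      | hadd x y _ _ hx hy => exact add_mem hx hy
    · rintro _ ⟨a, ha, rfl⟩
      exact ((koszul t).tensorInclude 𝒜).map_mem n a ha
    · rintro _ ⟨a, ha, rfl⟩
      have := SetLike.mul_mem_graded (koszulEps_mem t 𝒜)
        (((koszul t).tensorInclude 𝒜).map_mem (n - 1) a ha)
      rwa [add_sub_cancel] at this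
  rw [h]
  exact ((Module.Finite.iff_fg.1 (hA n)).map _).sup ((Module.Finite.iff_fg.1 (hA _)).map _)

theorem free_of_free_deg (hA : ∀ i, Module.Free R (𝒜.deg i)) : Module.Free R A :=
  Module.Free.of_equiv (DirectSum.decomposeLinearEquiv 𝒜.deg).symm

theorem koszulTensor_free (hA : ∀ i, Module.Free R (𝒜.deg i)) :
    Module.Free R ((koszul t).TensorType 𝒜) := by
  have := 𝒜.free_of_free_deg hA
  have : Module.Free R (DualNumber R) := inferInstanceAs (Module.Free R (R × R))
  exact Module.Free.of_equiv (GradedTensorProduct.of R (koszul t).deg 𝒜.deg)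

end DGAlgebra

/-! ### Operator identities behind the correction step -/

section NoncommutativeAlgebra

variable {R Q : Type*} [CommRing R] [Ring Q] [Algebra R Q]

/-- The cross terms add up to s(δe + eδ)w = sw, which cancels δ²; the quadratic term contains e² =
0. -/
theorem sq_zero_correction {δ e w : Q} {s : R} (hδδ : δ * δ = s • w) (hδw : δ * w = w * δ)
    (hδe : δ * e + e * δ = 1) (hee : e * e = 0) (hew : e * w = w * e) :
    (δ - s • (e * w)) * (δ - s • (e * w)) = 0 := by
  have h1 : δ * (e * w) + e * w * δ = w := by
    rw [mul_assoc e, ← hδw, ← mul_assoc, ← mul_assoc, ← add_mul, hδe, one_mul]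
  have h2 : e * w * (e * w) = 0 := by
    rw [mul_assoc, ← mul_assoc w, ← hew, mul_assoc e, ← mul_assoc, hee, zero_mul]
  simp only [mul_sub, sub_mul, smul_mul_assoc, mul_smul_comm, h2, hδδ]
  nth_rewrite 1 [← h1]
  simp only [smul_add, smul_zero]
  abel_nf

/-- The price of the correction by ew: since de + ed = t, the error in anticommuting with d is sw
times a further factor t. This is where one power of t is gained. -/
theorem anticommutator_correction {d δ e w : Q} {s t : R} (hdδ : d * δ + δ * d = 0)
    (hdw : d * w = w * d) (hde : d * e + e * d = t • 1) :
    d * (δ - s • (e * w)) + (δ - s • (e * w)) * d = -((s * t) • w) := by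
  have h1 : d * (e * w) + e * w * d = t • w := by
    rw [mul_assoc e, ← hdw, ← mul_assoc, ← mul_assoc, ← add_mul, hde, smul_mul_assoc, one_mul]
  rw [mul_smul, ← h1]
  simp only [mul_sub, sub_mul, smul_mul_assoc, mul_smul_comm, smul_add]
  rw [eq_neg_iff_add_eq_zero, ← hdδ]
  abel

theorem anticommutator_add_smul {d δ w f : Q} {s : R} (hdδ : d * δ + δ * d = -(s • w))
    (hw : w = d * f + f * d) : d * (δ + s • f) + (δ + s • f) * d = 0 := by
  simp only [mul_add, add_mul, smul_mul_assoc, mul_smul_comm]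
  rw [add_add_add_comm, hdδ, ← smul_add, ← hw, neg_add_cancel]

theorem mul_self_add_smul {δ f : Q} {s : R} (hδδ : δ * δ = 0) :
    (δ + s • f) * (δ + s • f) = s • (δ * f + f * δ + s • (f * f)) := by
  simp only [mul_add, add_mul, smul_mul_assoc, mul_smul_comm, smul_add, hδδ]
  abel

/-- The second factor is the quotient by s of the square of δ + sf. Commutation cannot be read off
from that square by cancelling s, as s may be a zero divisor; it is checked by expansion using δ² =
0. -/
theorem commute_anticommutator_add_smul {δ f : Q} {s : R} (hδδ : δ * δ = 0) :
    (δ + s • f) * (δ * f + f * δ + s • (f * f)) =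
      (δ * f + f * δ + s • (f * f)) * (δ + s • f) := by
  have h1 : δ * (δ * f) = 0 := by rw [← mul_assoc, hδδ, zero_mul]
  simp only [mul_add, add_mul, smul_mul_assoc, mul_smul_comm, smul_add, mul_assoc, hδδ, h1,
    mul_zero]
  abel

/-- The commutator with d is rearranged into brackets dδ + δd = -sw and df + fd = w; the terms in wf
and fw cancel, and the rest is the commutator of w and δ. -/
theorem commute_of_anticommutator {d δ w f : Q} {s : R} (hdδ : d * δ + δ * d = -(s • w))
    (hδw : δ * w = w * δ) (hw : w = d * f + f * d) :
    d * (δ * f + f * δ + s • (f * f)) = (δ * f + f * δ + s • (f * f)) * d := by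
  rw [← sub_eq_zero]
  have key : d * (δ * f + f * δ + s • (f * f)) - (δ * f + f * δ + s • (f * f)) * d =
      (d * δ + δ * d) * f - f * (d * δ + δ * d) - δ * (d * f + f * d) + (d * f + f * d) * δ +
        s • ((d * f + f * d) * f - f * (d * f + f * d)) := by
    simp only [mul_add, add_mul, mul_assoc, smul_mul_assoc, mul_smul_comm, smul_sub, smul_add]
    abel
  rw [key, hdδ, ← hw, hδw]
  simp only [neg_mul, mul_neg, smul_mul_assoc, mul_smul_comm, smul_sub]
  abel

end NoncommutativeAlgebra

/-! ### Adic sums and separatedness -/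

section Adic

variable {R : Type*} [CommRing R] {t : R} {M : Type*} [AddCommGroup M] [Module R M]

theorem mem_span_singleton_pow_smul_top {n : ℕ} {x : R} :
    x ∈ (Ideal.span {t} ^ n • ⊤ : Submodule R R) ↔ ∃ z, t ^ n * z = x := by
  rw [Ideal.span_singleton_pow, smul_eq_mul, Ideal.mul_top, Ideal.mem_span_singleton]
  exact ⟨fun ⟨z, hz⟩ => ⟨z, hz.symm⟩, fun ⟨z, hz⟩ => ⟨z, hz.symm⟩⟩

/-- Every coordinate of x in a basis is divisible by all powers of t, hence zero because R is
separated. -/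
theorem eq_zero_of_forall_eq_pow_smul [Module.Free R M] (ht : IsHausdorff (Ideal.span {t}) R)
    {x : M} (hx : ∀ n, ∃ z, t ^ n • z = x) : x = 0 := by
  rw [← (Module.Free.chooseBasis R M).forall_coord_eq_zero_iff]
  refine fun i => ht.haus _ fun n => ?_
  rw [SModEq.zero, mem_span_singleton_pow_smul_top]
  obtain ⟨z, rfl⟩ := hx n
  exact ⟨_, ((Module.Free.chooseBasis R M).coord i).map_smul _ z |>.symm⟩

theorem exists_adic_sum (ht : IsPrecomplete (Ideal.span {t}) R) (r : ℕ → R) :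
    ∃ L, ∀ n, ∃ z, t ^ n * z = L - ∑ k ∈ Finset.range n, t ^ k * r k := by
  obtain ⟨L, hL⟩ := ht.prec' (fun n => ∑ k ∈ Finset.range n, t ^ k * r k) (by
    intro m n hmn
    rw [SModEq.comm, SModEq.sub_mem, ← Finset.sum_Ico_eq_sub _ hmn]
    refine Submodule.sum_mem _ fun k hk => mem_span_singleton_pow_smul_top.2 ?_
    refine ⟨t ^ (k - m) * r k, ?_⟩
    rw [← mul_assoc, ← pow_add, Nat.add_sub_cancel' (Finset.mem_Ico.1 hk).1])
  refine ⟨L, fun n => mem_span_singleton_pow_smul_top.1 ?_⟩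
  rw [← SModEq.sub_mem, SModEq.comm]
  exact hL n

/-- Expand all the terms on one finite generating set and sum the coefficients in R. Only existence
of limits in R is used, so P need not be separated. -/
theorem Submodule.FG.exists_adic_sum (ht : IsPrecomplete (Ideal.span {t}) R)
    {P : Submodule R M} (hP : P.FG) {g : ℕ → M} (hg : ∀ k, g k ∈ P) :
    ∃ y ∈ P, ∀ n, ∃ z, t ^ n • z = y - ∑ k ∈ Finset.range n, t ^ k • g k := by
  obtain ⟨S, rfl⟩ := hP
  choose r _ hr using fun k => Submodule.mem_span_finset.1 (hg k)
  choose L hL using fun a : M => _root_.exists_adic_sum ht fun k => r k a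
  choose z hz using hL
  refine ⟨∑ a ∈ S, L a • a, Submodule.sum_mem _ fun a ha => Submodule.smul_mem _ _
    (Submodule.subset_span ha), fun n => ⟨∑ a ∈ S, z a n • a, ?_⟩⟩
  simp only [← hr, Finset.smul_sum, smul_smul]
  rw [Finset.sum_comm, ← Finset.sum_sub_distrib]
  refine Finset.sum_congr rfl fun a _ => ?_
  rw [hz, sub_smul, Finset.sum_smul]

end Adic

/-- A contraction on a DG algebra: an odd derivation `c` anticommuting with the differential, of
square zero, and an element `ε` of degree `1` with `c ε = 1` and `dε = t`. -/
structure DGAlgebra.Contraction {R A : Type*} [CommRing R] [Ring A] [Algebra R A]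
    (𝒜 : DGAlgebra R A) (t : R) where
  eps : A
  eps_mem : eps ∈ 𝒜.deg 1
  d_eps : 𝒜.d eps = t • 1
  c : A →ₗ[R] A
  c_mem : ∀ i, ∀ a ∈ 𝒜.deg i, c a ∈ 𝒜.deg (i - 1)
  c_c : ∀ a, c (c a) = 0
  c_mul : ∀ i, ∀ a ∈ 𝒜.deg i, ∀ b, c (a * b) = c a * b + i.negOnePow • (a * c b)
  c_eps : c eps = 1
  c_d : ∀ a, c (𝒜.d a) + 𝒜.d (c a) = 0

/-! ### Derivations along the contraction -/

namespace DGModule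

variable {R A : Type*} [CommRing R] [Ring A] [Algebra R A] {𝒜 : DGAlgebra R A}
variable {N : Type*} [AddCommGroup N] [Module R N] [Module A N] [IsScalarTower R A N]
variable {𝒩 : DGModule 𝒜 N}

/-- Operators of degree `-1` satisfying the Leibniz rule with respect to an operator `c` on the
algebra. -/
structure IsDerivationAlong (𝒩 : DGModule 𝒜 N) (c : A →ₗ[R] A) (δ : Module.End R N) : Prop where
  map_mem : ∀ i, ∀ x ∈ 𝒩.deg i, δ x ∈ 𝒩.deg (i - 1)
  map_smul : ∀ i, ∀ a ∈ 𝒜.deg i, ∀ x, δ (a • x) = c a • x + i.negOnePow • (a • δ x)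

theorem isDerivationAlong_d (𝒩 : DGModule 𝒜 N) : 𝒩.IsDerivationAlong 𝒜.d 𝒩.d :=
  ⟨𝒩.d_mem, 𝒩.leibniz⟩

/-- Allows skew-linear operators to be treated as derivations along 0, so that one anticommutator
lemma serves both kinds. -/
theorem isDerivationAlong_zero_iff {f : Module.End R N} :
    𝒩.IsDerivationAlong 0 f ↔ f ∈ homDeg 𝒩 𝒩 (-1) := by
  refine ⟨fun h => ⟨h.map_mem, fun i a ha x => ?_⟩, fun h => ⟨h.1, fun i a ha x => ?_⟩⟩
  · simpa using h.map_smul i a ha x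
  · simpa using h.2 i a ha x

namespace IsDerivationAlong

variable {c c' : A →ₗ[R] A} {δ δ' : Module.End R N}

theorem add (h : 𝒩.IsDerivationAlong c δ) (h' : 𝒩.IsDerivationAlong c' δ') :
    𝒩.IsDerivationAlong (c + c') (δ + δ') := by
  refine ⟨fun i x hx => add_mem (h.map_mem i x hx) (h'.map_mem i x hx), fun i a ha x => ?_⟩
  simp only [LinearMap.add_apply, h.map_smul i a ha, h'.map_smul i a ha, add_smul, smul_add]
  abel

theorem add_homDeg (h : 𝒩.IsDerivationAlong c δ) {f : Module.End R N}
    (hf : f ∈ homDeg 𝒩 𝒩 (-1)) : 𝒩.IsDerivationAlong c (δ + f) := by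
  simpa using h.add (isDerivationAlong_zero_iff.2 hf)

/-- In δ²(ax) the two mixed terms c(a)δ(x) have opposite signs, and the term in c² vanishes, so δ²
is linear although δ is not. -/
theorem mul_self_mem (h : 𝒩.IsDerivationAlong c δ) (hc : ∀ i, ∀ a ∈ 𝒜.deg i, c a ∈ 𝒜.deg (i - 1))
    (hcc : ∀ a, c (c a) = 0) : δ * δ ∈ homDeg 𝒩 𝒩 (-2) := by
  refine ⟨fun i x hx => ?_, fun i a ha x => ?_⟩
  · have := h.map_mem _ _ (h.map_mem i x hx)
    rwa [sub_sub] at this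
  · simp only [Module.End.mul_apply, h.map_smul i a ha, map_add, map_unit_smul,
      h.map_smul _ _ (hc i a ha), hcc, zero_smul, zero_add, smul_add, smul_smul]
    rw [Int.negOnePow_sub, Int.negOnePow_even (-2 * i) ⟨-i, by ring⟩]
    simp

theorem anticommutator_mem (h : 𝒩.IsDerivationAlong c δ) (h' : 𝒩.IsDerivationAlong c' δ')
    (hc : ∀ i, ∀ a ∈ 𝒜.deg i, c a ∈ 𝒜.deg (i - 1))
    (hc' : ∀ i, ∀ a ∈ 𝒜.deg i, c' a ∈ 𝒜.deg (i - 1))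
    (hcc : ∀ a, c (c' a) + c' (c a) = 0) : δ * δ' + δ' * δ ∈ homDeg 𝒩 𝒩 (-2) := by
  refine ⟨fun i x hx => ?_, fun i a ha x => ?_⟩
  · have h1 := h.map_mem _ _ (h'.map_mem i x hx)
    have h2 := h'.map_mem _ _ (h.map_mem i x hx)
    rw [sub_sub] at h1 h2
    exact add_mem h1 h2
  · simp only [LinearMap.add_apply, Module.End.mul_apply, h.map_smul i a ha, h'.map_smul i a ha,
      map_add, map_unit_smul, h.map_smul _ _ (hc' i a ha), h'.map_smul _ _ (hc i a ha), smul_add,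
      smul_smul]
    rw [Int.negOnePow_sub, Int.negOnePow_even (-2 * i) ⟨-i, by ring⟩,
      eq_neg_of_add_eq_zero_left (hcc a)]
    simp
    abel

end IsDerivationAlong

variable {t : R}

section EpsOperator

variable (C : 𝒜.Contraction t)

/-- Multiplication by `ε` on a DG module. -/
noncomputable def epsMul (N : Type*) [AddCommGroup N] [Module R N] [Module A N]
    [IsScalarTower R A N] : Module.End R N := Algebra.lsmul R R N C.eps

theorem epsMul_apply (x : N) : epsMul C N x = C.eps • x := rfl

theorem epsMul_mem (𝒩 : DGModule 𝒜 N) : epsMul C N ∈ homDeg 𝒩 𝒩 1 := by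
  refine ⟨fun i x hx => ?_, fun i a ha x => ?_⟩
  · rw [add_comm]; exact 𝒩.smul_mem _ _ _ C.eps_mem _ hx
  · rw [epsMul_apply, epsMul_apply, smul_smul, 𝒜.graded_comm 1 i _ C.eps_mem _ ha, unit_smul_smul,
      mul_smul]

theorem epsMul_mul_self : epsMul C N * epsMul C N = 0 := by
  ext x
  rw [Module.End.mul_apply, epsMul_apply, epsMul_apply, smul_smul,
    𝒜.sq_zero 1 odd_one _ C.eps_mem, zero_smul, LinearMap.zero_apply]

theorem d_anticommutator_epsMul (𝒩 : DGModule 𝒜 N) :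
    𝒩.d * epsMul C N + epsMul C N * 𝒩.d = t • 1 := by
  ext x
  simp [epsMul_apply, 𝒩.leibniz 1 _ C.eps_mem, C.d_eps]

theorem IsDerivationAlong.anticommutator_epsMul {δ : Module.End R N}
    (h : 𝒩.IsDerivationAlong C.c δ) : δ * epsMul C N + epsMul C N * δ = 1 := by
  ext x
  simp [epsMul_apply, h.map_smul 1 _ C.eps_mem, C.c_eps]

theorem epsMul_commute {w : Module.End R N} (hw : w ∈ homDeg 𝒩 𝒩 (-2)) :
    epsMul C N * w = w * epsMul C N := by
  ext x
  simp only [Module.End.mul_apply, epsMul_apply]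
  rw [hw.2 1 _ C.eps_mem, Int.negOnePow_even (-2 * 1) ⟨-1, rfl⟩, one_smul]

end EpsOperator

/-- `δ` is a derivation along the contraction that anticommutes with the differential and whose
square is divisible by `tⁿ`. -/
def IsApproxContraction (𝒩 : DGModule 𝒜 N) (C : 𝒜.Contraction t) (n : ℕ)
    (δ : Module.End R N) : Prop :=
  𝒩.IsDerivationAlong C.c δ ∧ 𝒩.d * δ + δ * 𝒩.d = 0 ∧ ∃ w ∈ homDeg 𝒩 𝒩 (-2),
    δ * δ = t ^ n • w ∧ 𝒩.d * w = w * 𝒩.d ∧ δ * w = w * δ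

theorem d_mul_d (𝒩 : DGModule 𝒜 N) : (𝒩.d * 𝒩.d : Module.End R N) = 0 :=
  LinearMap.ext 𝒩.d_d

/-- Subtracting tⁿεw kills the square and leaves the anticommutator error -tⁿ⁺¹w; adding tⁿ⁺¹f with
w = df + fd removes that error at the cost of a square divisible by tⁿ⁺¹. -/
theorem IsApproxContraction.exists_improvement {C : 𝒜.Contraction t}
    (hExt : ∀ w : Module.End R N, w ∈ homDeg 𝒩 𝒩 (-2) → 𝒩.d * w = w * 𝒩.d →
      ∃ f : Module.End R N, f ∈ homDeg 𝒩 𝒩 (-1) ∧ w = 𝒩.d * f + f * 𝒩.d)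
    {n : ℕ} {δ : Module.End R N} (h : 𝒩.IsApproxContraction C n δ) :
    ∃ g : Module.End R N, g ∈ homDeg 𝒩 𝒩 (-1) ∧
      𝒩.IsApproxContraction C (n + 1) (δ + t ^ n • g) := by
  obtain ⟨hδ, hdδ, w, hw, hδδ, hdw, hδw⟩ := h
  obtain ⟨f, hf, hwf⟩ := hExt w hw hdw
  have hew : epsMul C N * w ∈ homDeg 𝒩 𝒩 (-1) := comp_mem_homDeg (epsMul_mem C 𝒩) hw
  have hD : 𝒩.IsDerivationAlong C.c (δ - t ^ n • (epsMul C N * w)) := by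
    rw [sub_eq_add_neg]
    exact hδ.add_homDeg (neg_mem (Submodule.smul_mem _ _ hew))
  have hDD := sq_zero_correction hδδ hδw (hδ.anticommutator_epsMul C) (epsMul_mul_self C)
    (epsMul_commute C hw)
  have hdD := anticommutator_correction (s := t ^ n) hdδ hdw (d_anticommutator_epsMul C 𝒩)
  rw [← pow_succ] at hdD
  have hDw : (δ - t ^ n • (epsMul C N * w)) * w = w * (δ - t ^ n • (epsMul C N * w)) := by
    simp only [sub_mul, mul_sub, smul_mul_assoc, mul_smul_comm, hδw]
    rw [epsMul_commute C hw, mul_assoc, ← epsMul_commute C hw]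
  -- Both corrections together form tⁿ(tf - εw); the common factor tⁿ is what makes the corrections
  -- summable.
  have hδ' : δ + t ^ n • (t • f - epsMul C N * w) =
      δ - t ^ n • (epsMul C N * w) + t ^ (n + 1) • f := by
    rw [smul_sub, smul_smul, pow_succ]; abel
  refine ⟨t • f - epsMul C N * w, sub_mem (Submodule.smul_mem _ _ hf) hew, ?_⟩
  rw [hδ']
  refine ⟨hD.add_homDeg (Submodule.smul_mem _ _ hf), anticommutator_add_smul hdD hwf,
    _, add_mem ?_ (Submodule.smul_mem _ _ (comp_mem_homDeg hf hf)), mul_self_add_smul hDD,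
    commute_of_anticommutator hdD hDw hwf, commute_anticommutator_add_smul hDD⟩
  exact hD.anticommutator_mem (isDerivationAlong_zero_iff.2 hf) C.c_mem (by simp) (by simp)

/-! ### Starting point and limit of the approximations -/

section Limit

variable {ι : Type*} (b : Module.Basis ι A N) {D : ι → ℤ}

theorem isDerivationAlong_basisMap (hD : ∀ i, b i ∈ 𝒩.deg (D i)) (C : 𝒜.Contraction t) :
    𝒩.IsDerivationAlong C.c (basisMap b C.c b) := by
  refine ⟨fun i x hx => ?_, fun i a ha x => ?_⟩
  · have := basisMap_mem_deg b hD (p := -1) (n := 0) C.c_mem (y := b) (by simpa using hD) hx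
    rwa [add_zero, ← sub_eq_add_neg] at this
  · induction x using basis_induction (𝒜 := 𝒜) b with
    | h0 => simp
    | hadd x y hx hy => simp only [smul_add, map_add, hx, hy]; abel
    | hs k q a' ha' =>
      rw [smul_smul, basisMap_smul_basis, basisMap_smul_basis, C.c_mul i a ha, add_smul,
        unit_smul_smul, mul_smul, mul_smul]

/-- The anticommutator of d with the basis derivation is a linear cycle of degree -2, hence a
boundary df + fd, and subtracting f makes it vanish. For exponent 0 no divisibility is required, and
w is the square itself. -/
theorem exists_isApproxContraction_zero (hD : ∀ i, b i ∈ 𝒩.deg (D i)) (C : 𝒜.Contraction t)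
    (hExt : ∀ w : Module.End R N, w ∈ homDeg 𝒩 𝒩 (-2) → 𝒩.d * w = w * 𝒩.d →
      ∃ f : Module.End R N, f ∈ homDeg 𝒩 𝒩 (-1) ∧ w = 𝒩.d * f + f * 𝒩.d) :
    ∃ δ, 𝒩.IsApproxContraction C 0 δ := by
  have hδ := isDerivationAlong_basisMap b hD C
  obtain ⟨f, hf, hwf⟩ := hExt _
    ((isDerivationAlong_d 𝒩).anticommutator_mem hδ 𝒜.d_mem C.c_mem
      fun a => by rw [add_comm]; exact C.c_d a) (by
      rw [mul_add, add_mul, ← mul_assoc, d_mul_d, mul_assoc _ 𝒩.d 𝒩.d, d_mul_d, mul_zero, zero_mul,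
        zero_add, add_zero, mul_assoc])
  have hδ' := hδ.add_homDeg (neg_mem hf)
  have hdδ' : 𝒩.d * (basisMap b C.c b + -f) + (basisMap b C.c b + -f) * 𝒩.d = 0 := by
    rw [mul_add, add_mul, add_add_add_comm, hwf]
    simp only [mul_neg, neg_mul]
    abel
  refine ⟨_, hδ', hdδ', _, hδ'.mul_self_mem C.c_mem C.c_c, by rw [pow_zero, one_smul], ?_,
    mul_assoc _ _ _ |>.symm⟩
  rw [← mul_assoc, eq_neg_of_add_eq_zero_left hdδ', neg_mul, mul_assoc,
    eq_neg_of_add_eq_zero_left hdδ', mul_neg, neg_neg, mul_assoc]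

/-- Only the finitely many basis elements of degree at most k contribute to degree k, each through
one finitely generated degree of the algebra. -/
theorem deg_fg (hD : ∀ i, b i ∈ 𝒩.deg (D i)) (hfin : ∀ k, {i | D i ≤ k}.Finite)
    (hfg : ∀ k, (𝒜.deg k).FG) (k : ℤ) : (𝒩.deg k).FG := by
  have h : 𝒩.deg k = ⨆ i ∈ (hfin k).toFinset, (𝒜.deg (k - D i)).map
      ((LinearMap.toSpanSingleton A N (b i)).restrictScalars R) := by
    refine le_antisymm (fun x hx => ?_) (iSup₂_le fun i _ => ?_)
    · rw [← b.linearCombination_repr x, Finsupp.linearCombination_apply, Finsupp.sum]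
      refine Submodule.sum_mem _ fun i hi => ?_
      refine Submodule.mem_iSup_of_mem i (Submodule.mem_iSup_of_mem ?_
        ⟨_, repr_mem_deg b hD hx i, rfl⟩)
      rw [Set.Finite.mem_toFinset]
      by_contra hlt
      exact (Finsupp.mem_support_iff.1 hi) (repr_eq_zero_of_lt b hD hx (not_le.1 hlt))
    · rintro _ ⟨a, ha, rfl⟩
      have := 𝒩.smul_mem _ _ a ha _ (hD i)
      rwa [sub_add_cancel] at this
  rw [h]
  exact Submodule.fg_biSup _ _ fun i _ => (hfg _).map _

/-- The submodule `tⁿ N`. -/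
def powSMul (A : Type*) (N : Type*) [Ring A] [Algebra R A] [AddCommGroup N] [Module R N]
    [Module A N] [IsScalarTower R A N] (t : R) (n : ℕ) : Submodule A N :=
  LinearMap.range (t ^ n • (LinearMap.id : N →ₗ[A] N))

theorem mem_powSMul {n : ℕ} {x : N} : x ∈ powSMul A N t n ↔ ∃ z, t ^ n • z = x := Iff.rfl

theorem map_mem_powSMul (f : Module.End R N) {n : ℕ} {x : N} (hx : x ∈ powSMul A N t n) :
    f x ∈ powSMul A N t n := by
  obtain ⟨z, rfl⟩ := mem_powSMul.1 hx
  exact mem_powSMul.2 ⟨f z, (map_smul f _ _).symm⟩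

theorem exists_homDeg_adic_sum (hD : ∀ i, b i ∈ 𝒩.deg (D i)) (hfin : ∀ k, {i | D i ≤ k}.Finite)
    (hfg : ∀ k, (𝒜.deg k).FG) (ht : IsPrecomplete (Ideal.span {t}) R) {g : ℕ → Module.End R N}
    {m : ℤ} (hg : ∀ n, g n ∈ homDeg 𝒩 𝒩 m) :
    ∃ f : Module.End R N, f ∈ homDeg 𝒩 𝒩 m ∧
      ∀ n x, (f - ∑ k ∈ Finset.range n, t ^ k • g k) x ∈ powSMul A N t n := by
  -- The sums are formed at basis elements only. The error estimate then extends to all of N because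
  -- the error is skew-linear and tⁿN is a submodule over the algebra.
  choose y hy hyt using fun i => (deg_fg b hD hfin hfg (D i + m)).exists_adic_sum ht
    (g := fun k => g k (b i)) fun k => (hg k).1 _ _ (hD i)
  have hf : skewExtend (𝒜 := 𝒜) b m y ∈ homDeg 𝒩 𝒩 m := skewExtend_mem b hD hy
  refine ⟨_, hf, fun n x => homDeg_apply_mem_of_mem_span (ℳ := 𝒩) (𝒩 := 𝒩) (n := m)
    (sub_mem hf (Submodule.sum_mem _ fun k _ => Submodule.smul_mem _ _ (hg k)))
    (s := Set.range b) ?_ (by rw [b.span_eq]; trivial)⟩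
  rintro _ ⟨i, rfl⟩
  obtain ⟨z, hz⟩ := hyt i n
  refine mem_powSMul.2 ⟨z, ?_⟩
  rw [hz, LinearMap.sub_apply, skewExtend_basis]
  simp

/-- If all cycles of degree `-2` of `Hom(N, N)` are boundaries, then the contraction of the algebra
extends to a square-zero derivation of `N` that anticommutes with the differential. -/
theorem exists_isDerivationAlong_mul_self_eq_zero (hD : ∀ i, b i ∈ 𝒩.deg (D i))
    (hfin : ∀ k, {i | D i ≤ k}.Finite) (hfg : ∀ k, (𝒜.deg k).FG)
    (ht : IsAdicComplete (Ideal.span {t}) R) [Module.Free R N] (C : 𝒜.Contraction t)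
    (hExt : ∀ w : Module.End R N, w ∈ homDeg 𝒩 𝒩 (-2) → 𝒩.d * w = w * 𝒩.d →
      ∃ f : Module.End R N, f ∈ homDeg 𝒩 𝒩 (-1) ∧ w = 𝒩.d * f + f * 𝒩.d) :
    ∃ δ : Module.End R N, 𝒩.IsDerivationAlong C.c δ ∧ 𝒩.d * δ + δ * 𝒩.d = 0 ∧ δ * δ = 0 := by
  obtain ⟨δ₀, hδ₀⟩ := exists_isApproxContraction_zero b hD C hExt
  choose G hG hG' using fun (n : ℕ) (δ : {δ // 𝒩.IsApproxContraction C n δ}) =>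
    δ.2.exists_improvement hExt
  let s : (n : ℕ) → {δ // 𝒩.IsApproxContraction C n δ} := fun n =>
    Nat.rec ⟨δ₀, hδ₀⟩ (fun n δ => ⟨_, hG' n δ⟩) n
  let g : ℕ → Module.End R N := fun n => G n (s n)
  have hg : ∀ n, g n ∈ homDeg 𝒩 𝒩 (-1) := fun n => hG _ _
  have hs : ∀ n, (s n).1 = δ₀ + ∑ k ∈ Finset.range n, t ^ k • g k := by
    intro n
    induction n with
    | zero => simp [s]
    | succ n ih =>
      rw [Finset.sum_range_succ, ← add_assoc, ← ih]
  obtain ⟨f, hf, hft⟩ := exists_homDeg_adic_sum b hD hfin hfg ht.toIsPrecomplete hg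
  -- The limit differs from the n-th approximation by an operator with values in tⁿN.
  have key : ∀ n, ∃ h : Module.End R N, δ₀ + f = (s n).1 + h ∧ ∀ x, h x ∈ powSMul A N t n := by
    refine fun n => ⟨_, ?_, hft n⟩
    rw [hs]; abel
  have hzero : ∀ Φ : Module.End R N, (∀ n x, Φ x ∈ powSMul A N t n) → Φ = 0 := fun Φ h =>
    LinearMap.ext fun x => eq_zero_of_forall_eq_pow_smul ht.toIsHausdorff fun n => h n x
  refine ⟨δ₀ + f, hδ₀.1.add_homDeg hf, hzero _ fun n x => ?_, hzero _ fun n x => ?_⟩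
  -- The n-th approximation anticommutes with d exactly, so the anticommutator of the limit is dh +
  -- hd, with values in tⁿN.
  · obtain ⟨h, hh, hht⟩ := key n
    have e := (s n).2.2.1
    rw [hh, mul_add, add_mul, add_add_add_comm, e, zero_add]
    exact add_mem (map_mem_powSMul 𝒩.d (hht x)) (hht _)
  -- Modulo tⁿN the square of the limit is that of the n-th approximation, which is tⁿw.
  · obtain ⟨h, hh, hht⟩ := key n
    obtain ⟨w, -, hw, -⟩ := (s n).2.2.2
    rw [hh, mul_add, add_mul, hw]
    exact add_mem (add_mem (mem_powSMul.2 ⟨w x, rfl⟩) (hht _)) (map_mem_powSMul ((s n).1 + h) (hht x))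

end Limit

end DGModule

/-- The contraction of `K(t) ⊗ A`. -/
noncomputable def DGAlgebra.koszulContraction {R A : Type*} [CommRing R] [Ring A] [Algebra R A]
    (t : R) (𝒜 : DGAlgebra R A) : ((koszul t).tensor 𝒜).Contraction t where
  eps := koszulEps t 𝒜
  eps_mem := koszulEps_mem t 𝒜
  d_eps := d_koszulEps t 𝒜
  c := contraction t 𝒜
  c_mem _ _ := contraction_mem t 𝒜
  c_c := contraction_contraction t 𝒜
  c_mul _ _ := contraction_mul t 𝒜
  c_eps := contraction_koszulEps t 𝒜
  c_d := contraction_d_add_d_contraction t 𝒜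

namespace DGModule

/-! ### Induced DG modules and maps out of a base change -/

section Pullback

variable {R A B : Type*} [CommRing R] [Ring A] [Algebra R A] [Ring B] [Algebra R B]
  {𝒜 : DGAlgebra R A} {ℬ : DGAlgebra R B}
variable {N : Type*} [AddCommGroup N] [Module R N] [Module B N] [IsScalarTower R B N]
variable {M : Type*} [AddCommGroup M] [Module R M] [Module A M] [IsScalarTower R A M]

theorem comap_isInternal (𝒩 : DGModule ℬ N) {ψ : M →ₗ[R] N} {l : N →ₗ[R] M}
    (hlψ : ∀ m, l (ψ m) = m) (hψl : ∀ i, ∀ x ∈ 𝒩.deg i, ψ (l x) ∈ 𝒩.deg i) :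
    DirectSum.IsInternal fun i => (𝒩.deg i).comap ψ := by
  refine isInternal_of_coaction _ (Submodule.eq_top_iff'.2 fun m => ?_)
    (Finsupp.mapRange.linearMap l ∘ₗ gradedCoaction 𝒩.deg ∘ₗ ψ) fun i m hm => ?_
  · rw [← hlψ m]
    generalize ψ m = x
    induction x using DirectSum.Decomposition.inductionOn 𝒩.deg with
    | zero => simp
    | add x y hx hy => rw [map_add]; exact add_mem hx hy
    | @homogeneous i x => exact Submodule.mem_iSup_of_mem i (hψl i x x.2)
  · rw [LinearMap.comp_apply, LinearMap.comp_apply, gradedCoaction_of_mem _ hm]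
    simp [hlψ]

/-- The structure of a DG `A`-module induced on an `R`-linear retract `M` of a DG `B`-module. -/
noncomputable def pullback (f : DGAlgebra.Hom 𝒜 ℬ) (𝒩 : DGModule ℬ N) (ψ : M →ₗ[R] N)
    (l : N →ₗ[R] M) (hψ : ∀ a m, ψ (a • m) = f.toAlgHom a • ψ m) (hlψ : ∀ m, l (ψ m) = m)
    (hψl : ∀ i, ∀ x ∈ 𝒩.deg i, ψ (l x) ∈ 𝒩.deg i)
    (hd : ∀ m, ψ (l (𝒩.d (ψ m))) = 𝒩.d (ψ m)) : DGModule 𝒜 M where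
  deg i := (𝒩.deg i).comap ψ
  isInternal := comap_isInternal 𝒩 hlψ hψl
  smul_mem i j a ha m hm := by
    rw [Submodule.mem_comap, hψ]
    exact 𝒩.smul_mem _ _ _ (f.map_mem i a ha) _ hm
  d := l ∘ₗ 𝒩.d ∘ₗ ψ
  d_mem i m hm := by
    change ψ (l (𝒩.d (ψ m))) ∈ 𝒩.deg (i - 1)
    rw [hd]
    exact 𝒩.d_mem _ _ hm
  d_d m := by
    change l (𝒩.d (ψ (l (𝒩.d (ψ m))))) = 0
    rw [hd, 𝒩.d_d, map_zero]
  leibniz i a ha m := by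
    change l (𝒩.d (ψ (a • m))) = 𝒜.d a • m + i.negOnePow • (a • l (𝒩.d (ψ m)))
    rw [← hlψ (𝒜.d a • m), ← hlψ (a • l _), ← map_unit_smul, ← map_add, hψ, hψ, hψ, hd,
      𝒩.leibniz i _ (f.map_mem i a ha), f.map_d]

/-- The `B`-linear map `B ⊗_A M → N` induced by a map `M → N` that is semilinear along `A → B`. -/
noncomputable def baseChangeDesc (f : DGAlgebra.Hom 𝒜 ℬ) (ψ : M →ₗ[R] N)
    (hψ : ∀ a m, ψ (a • m) = f.toAlgHom a • ψ m) : BaseChangeType f M →ₗ[B] N :=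
  (baseChangeRel f M).liftQ
    (TensorProduct.AlgebraTensorModule.lift (LinearMap.toSpanSingleton B (M →ₗ[R] N) ψ)) (by
    refine Submodule.span_le.2 ?_
    rintro _ ⟨b, a, m, rfl⟩
    change TensorProduct.AlgebraTensorModule.lift _ _ = 0
    simp [hψ, mul_smul])

end Pullback

/-! ### The kernel of δ as a lifting -/

section KoszulLifting

variable {R A : Type*} [CommRing R] [Ring A] [Algebra R A] {𝒜 : DGAlgebra R A} {t : R}
variable {N : Type*} [AddCommGroup N] [Module R N] [Module ((DGAlgebra.koszul t).TensorType 𝒜) N]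
  [IsScalarTower R ((DGAlgebra.koszul t).TensorType 𝒜) N]
variable {𝒩 : DGModule ((DGAlgebra.koszul t).tensor 𝒜) N} {δ : Module.End R N}

open DGAlgebra

theorem IsDerivationAlong.map_koszulIncl_smul
    (h : 𝒩.IsDerivationAlong (koszulContraction t 𝒜).c δ) {i : ℤ} {a : A} (ha : a ∈ 𝒜.deg i)
    (x : N) : δ (koszulIncl t 𝒜 a • x) = i.negOnePow • (koszulIncl t 𝒜 a • δ x) := by
  rw [h.map_smul i _ (((koszul t).tensorInclude 𝒜).map_mem i a ha)]
  have hc : (koszulContraction t 𝒜).c (koszulIncl t 𝒜 a) = 0 := contraction_koszulIncl t 𝒜 a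
  rw [hc]
  have hz : (0 : (koszul t).TensorType 𝒜) • x = 0 :=
    zero_smul ((koszul t).TensorType 𝒜) x
  exact (congrArg (· + _) hz).trans (zero_add _)

theorem IsDerivationAlong.map_koszulEps_smul
    (h : 𝒩.IsDerivationAlong (koszulContraction t 𝒜).c δ) (x : N) :
    δ (koszulEps t 𝒜 • x) = x - koszulEps t 𝒜 • δ x :=
  eq_sub_of_add_eq (LinearMap.congr_fun (h.anticommutator_epsMul (koszulContraction t 𝒜)) x)

theorem koszulEps_smul_smul (x : N) : koszulEps t 𝒜 • koszulEps t 𝒜 • x = 0 :=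
  LinearMap.congr_fun (epsMul_mul_self (N := N) (koszulContraction t 𝒜)) x

/-- The signs from moving a past ε and past δ cancel. Thus x ↦ δ(εx), which becomes the projection
onto ker δ along εN once δ² = 0, is strictly linear over A. -/
theorem IsDerivationAlong.map_koszulEps_smul_koszulIncl_smul
    (h : 𝒩.IsDerivationAlong (koszulContraction t 𝒜).c δ) (a : A) (x : N) :
    δ (koszulEps t 𝒜 • koszulIncl t 𝒜 a • x) = koszulIncl t 𝒜 a • δ (koszulEps t 𝒜 • x) := by
  induction a using DirectSum.Decomposition.inductionOn 𝒜.deg with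
  | zero =>
    have hz : ∀ y : N, koszulIncl t 𝒜 0 • y = 0 := fun y =>
      (congrArg (· • y) (map_zero _)).trans (zero_smul _ y)
    rw [hz, hz, smul_zero, map_zero]
  | add a a' ha ha' => simp only [map_add, add_smul, smul_add, ha, ha']
  | @homogeneous i a =>
    rw [smul_smul, ((koszul t).tensor 𝒜).graded_comm 1 i _ (koszulEps_mem t 𝒜) _
      (((koszul t).tensorInclude 𝒜).map_mem i a a.2), unit_smul_smul, mul_smul, map_unit_smul,
      h.map_koszulIncl_smul a.2, smul_smul, one_mul]
    simp

variable {ι : Type*} (b : Module.Basis ι ((koszul t).TensorType 𝒜) N)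

/-- The `A`-linear map sending the standard basis to the elements `δ(ε bᵢ)`. -/
noncomputable def kernelIncl (δ : Module.End R N) : (ι →₀ A) →ₗ[R] N :=
  Finsupp.lsum R fun i => ((LinearMap.toSpanSingleton ((koszul t).TensorType 𝒜) N
    (δ (koszulEps t 𝒜 • b i))).restrictScalars R) ∘ₗ (koszulIncl t 𝒜).toLinearMap

theorem kernelIncl_single (i : ι) (a : A) :
    kernelIncl b δ (Finsupp.single i a) = koszulIncl t 𝒜 a • δ (koszulEps t 𝒜 • b i) := by
  rw [kernelIncl, Finsupp.lsum_single]
  rfl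

theorem kernelIncl_smul (a : A) (m : ι →₀ A) :
    kernelIncl b δ (a • m) = koszulIncl t 𝒜 a • kernelIncl b δ m := by
  induction m using Finsupp.induction_linear with
  | zero => simp
  | add x y hx hy => simp only [smul_add, map_add, hx, hy]
  | single i a' =>
    rw [Finsupp.smul_single, kernelIncl_single, kernelIncl_single, smul_eq_mul, map_mul, mul_smul]

/-- The coordinates of an element modulo `ε`. -/
noncomputable def augCoords : N →ₗ[R] (ι →₀ A) :=
  Finsupp.mapRange.linearMap (koszulAug t 𝒜) ∘ₗ (b.repr.toLinearMap.restrictScalars R)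

theorem augCoords_smul_basis (x : (koszul t).TensorType 𝒜) (i : ι) :
    augCoords b (x • b i) = Finsupp.single i (koszulAug t 𝒜 x) := by
  simp [augCoords]

theorem augCoords_koszulEps_smul (x : N) : augCoords b (koszulEps t 𝒜 • x) = 0 := by
  induction x using basis_induction (𝒜 := (koszul t).tensor 𝒜) b with
  | h0 => simp
  | hadd x y hx hy => rw [smul_add, map_add, hx, hy, add_zero]
  | hs i k a ha =>
    rw [smul_smul, augCoords_smul_basis, koszulAug_koszulEps_mul, Finsupp.single_zero]

/-- The operator x ↦ δ(εx) is A-linear and kills εN, so it depends only on the coordinates of x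
modulo ε. -/
theorem kernelIncl_augCoords (h : 𝒩.IsDerivationAlong (koszulContraction t 𝒜).c δ) (x : N) :
    kernelIncl b δ (augCoords b x) = δ (koszulEps t 𝒜 • x) := by
  induction x using basis_induction (𝒜 := (koszul t).tensor 𝒜) b with
  | h0 => simp
  | hadd x y hx hy => simp only [smul_add, map_add, hx, hy]
  | hs i k β hβ =>
    rw [augCoords_smul_basis, kernelIncl_single]
    obtain ⟨a, ha⟩ := exists_eq_koszulIncl_add t 𝒜 β
    conv_rhs => rw [ha]
    rw [add_smul, smul_add, map_add, mul_smul, koszulEps_smul_smul, map_zero, add_zero,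
      h.map_koszulEps_smul_koszulIncl_smul]

/-- Modulo ε, the element δ(εbᵢ) = bᵢ - εδ(bᵢ) is bᵢ itself. Hence the elements δ(εbᵢ) are
independent over A. -/
theorem augCoords_kernelIncl (h : 𝒩.IsDerivationAlong (koszulContraction t 𝒜).c δ)
    (m : ι →₀ A) : augCoords b (kernelIncl b δ m) = m := by
  induction m using Finsupp.induction_linear with
  | zero => simp
  | add x y hx hy => simp only [map_add, hx, hy]
  | single i a =>
    rw [kernelIncl_single, ← h.map_koszulEps_smul_koszulIncl_smul, h.map_koszulEps_smul, map_sub,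
      augCoords_koszulEps_smul, sub_zero, augCoords_smul_basis, koszulAug_koszulIncl]

theorem map_kernelIncl (h : 𝒩.IsDerivationAlong (koszulContraction t 𝒜).c δ) (hδ : δ * δ = 0)
    (m : ι →₀ A) : δ (kernelIncl b δ m) = 0 := by
  rw [← augCoords_kernelIncl b h m, kernelIncl_augCoords b h]
  exact LinearMap.congr_fun hδ _

/-- If δx = 0, then δε + εδ = 1 gives δ(εx) = x: every element of ker δ is reached by `kernelIncl`.
-/
theorem kernelIncl_augCoords_of_map_eq_zero
    (h : 𝒩.IsDerivationAlong (koszulContraction t 𝒜).c δ) {x : N} (hx : δ x = 0) :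
    kernelIncl b δ (augCoords b x) = x := by
  rw [kernelIncl_augCoords b h, h.map_koszulEps_smul, hx, smul_zero, sub_zero]

theorem kernelIncl_augCoords_mem (h : 𝒩.IsDerivationAlong (koszulContraction t 𝒜).c δ) (i : ℤ)
    (x : N) (hx : x ∈ 𝒩.deg i) : kernelIncl b δ (augCoords b x) ∈ 𝒩.deg i := by
  rw [kernelIncl_augCoords b h]
  have := h.map_mem _ _ (𝒩.smul_mem _ _ _ (koszulEps_mem t 𝒜) _ hx)
  rwa [add_sub_cancel_left] at this

theorem kernelIncl_augCoords_d (h : 𝒩.IsDerivationAlong (koszulContraction t 𝒜).c δ)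
    (hδ : δ * δ = 0) (hdδ : 𝒩.d * δ + δ * 𝒩.d = 0) (m : ι →₀ A) :
    kernelIncl b δ (augCoords b (𝒩.d (kernelIncl b δ m))) = 𝒩.d (kernelIncl b δ m) := by
  refine kernelIncl_augCoords_of_map_eq_zero b h ?_
  have := LinearMap.congr_fun hdδ (kernelIncl b δ m)
  simpa [map_kernelIncl b h hδ] using this

theorem exists_baseChangeMk_eq (z : BaseChangeType ((koszul t).tensorInclude 𝒜) (ι →₀ A)) :
    ∃ m m' : ι →₀ A, z = baseChangeMk _ (1 ⊗ₜ m) + baseChangeMk _ (koszulEps t 𝒜 ⊗ₜ m') := by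
  obtain ⟨y, rfl⟩ := baseChangeMk_surjective _ z
  induction y with
  | zero => exact ⟨0, 0, by simp⟩
  | add x y hx hy =>
    obtain ⟨m, m', h⟩ := hx
    obtain ⟨n, n', h'⟩ := hy
    refine ⟨m + n, m' + n', ?_⟩
    rw [map_add, h, h', TensorProduct.tmul_add, TensorProduct.tmul_add, map_add, map_add]
    abel
  | tmul β m =>
    obtain ⟨a, ha⟩ := exists_eq_koszulIncl_add t 𝒜 β
    refine ⟨koszulAug t 𝒜 β • m, a • m, ?_⟩
    have e1 := baseChangeMk_rel ((koszul t).tensorInclude 𝒜) 1 (koszulAug t 𝒜 β) m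
    have e2 := baseChangeMk_rel ((koszul t).tensorInclude 𝒜) (koszulEps t 𝒜) a m
    rw [map_sub, sub_eq_zero] at e1 e2
    rw [one_mul] at e1
    rw [← e1, ← e2, ← map_add, ← TensorProduct.add_tmul, ← ha]

/-- The free A-module on the basis is identified with ker δ and inherits its grading and
differential. The decomposition x = δ(εx) + ε·δ(x) shows that N is ker δ ⊕ ε ker δ, which is the
base change of ker δ. -/
theorem exists_isLifting (hb : 𝒩.IsBoundedBelow) {D : ι → ℤ} (hD : ∀ i, b i ∈ 𝒩.deg (D i))
    (h : 𝒩.IsDerivationAlong (koszulContraction t 𝒜).c δ)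
    (hδ : δ * δ = 0) (hdδ : 𝒩.d * δ + δ * 𝒩.d = 0) :
    ∃ ℳ : DGModule 𝒜 (ι →₀ A), ℳ.IsSemifree ∧ IsLifting ((koszul t).tensorInclude 𝒜) 𝒩 ℳ := by
  let ℳ : DGModule 𝒜 (ι →₀ A) := pullback ((koszul t).tensorInclude 𝒜) 𝒩 (kernelIncl b δ)
    (augCoords b) (kernelIncl_smul b) (augCoords_kernelIncl b h) (kernelIncl_augCoords_mem b h)
    (kernelIncl_augCoords_d b h hδ hdδ)
  have hinj : Function.Injective (kernelIncl b δ) :=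
    Function.LeftInverse.injective (augCoords_kernelIncl b h)
  let Φ := baseChangeDesc ((koszul t).tensorInclude 𝒜) (kernelIncl b δ) (kernelIncl_smul b)
  have hΦ : ∀ β m, Φ (baseChangeMk _ (β ⊗ₜ m)) = β • kernelIncl b δ m := fun _ _ => rfl
  have hΦinj : Function.Injective Φ := by
    refine (injective_iff_map_eq_zero Φ).2 fun z hz => ?_
    obtain ⟨m, m', rfl⟩ := exists_baseChangeMk_eq z
    rw [map_add, hΦ, hΦ, one_smul] at hz
    -- Applying δ to a relation m + εm' = 0 in N, with m and m' in ker δ, leaves m' = 0, and then m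
    -- = 0.
    have hm' := congrArg δ hz
    rw [map_add, map_kernelIncl b h hδ, h.map_koszulEps_smul, map_kernelIncl b h hδ, smul_zero,
      sub_zero, zero_add, map_zero] at hm'
    rw [hm', smul_zero, add_zero] at hz
    rw [(map_eq_zero_iff _ hinj).1 hz, (map_eq_zero_iff _ hinj).1 hm']
    simp
  have hΦinv : ∀ x, Φ (baseChangeMk _ (1 ⊗ₜ augCoords b x) +
      baseChangeMk _ (koszulEps t 𝒜 ⊗ₜ augCoords b (δ x))) = x := by
    intro x
    rw [map_add, hΦ, hΦ, one_smul, kernelIncl_augCoords b h,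
      kernelIncl_augCoords_of_map_eq_zero b h (LinearMap.congr_fun hδ x), h.map_koszulEps_smul,
      sub_add_cancel]
  let e := LinearEquiv.ofBijective Φ ⟨hΦinj, fun x => ⟨_, hΦinv x⟩⟩
  have hΦd : ∀ z, Φ (baseChangeD _ ℳ z) = 𝒩.d (Φ z) := by
    intro z
    obtain ⟨y, rfl⟩ := baseChangeMk_surjective _ z
    rw [baseChangeD_mk]
    induction y using tensor_homogeneous_induction ((koszul t).tensor 𝒜).deg ℳ.deg with
    | h0 => simp
    | hadd x y hx hy => simp only [map_add, hx, hy]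
    | h i j β hβ m hm =>
      rw [tensorD_tmul _ _ _ hβ, map_add, map_add, map_unit_smul, map_unit_smul, hΦ, hΦ, hΦ,
        𝒩.leibniz i β hβ]
      congr 3
      exact kernelIncl_augCoords_d b h hδ hdδ m
  refine ⟨ℳ, ⟨?_, Set.range fun i => Finsupp.single i 1, ?_, ?_, ?_⟩, ⟨⟨e.symm, ?_, ?_⟩⟩⟩
  · obtain ⟨n, hn⟩ := hb
    refine ⟨n, fun i hi => (Submodule.eq_bot_iff _).2 fun m hm => ?_⟩
    have hm' : kernelIncl b δ m ∈ 𝒩.deg i := hm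
    rw [hn i hi, Submodule.mem_bot] at hm'
    exact (map_eq_zero_iff _ hinj).1 hm'
  · rintro _ ⟨i, rfl⟩
    refine ⟨D i, ?_⟩
    change kernelIncl b δ _ ∈ 𝒩.deg (D i)
    rw [kernelIncl_single, map_one, one_smul, ← kernelIncl_augCoords b h]
    exact kernelIncl_augCoords_mem b h _ _ (hD i)
  · have := (Finsupp.basisSingleOne (R := A) (ι := ι)).linearIndependent.linearIndepOn_id
    rw [Finsupp.coe_basisSingleOne] at this
    exact this
  · rw [← Finsupp.coe_basisSingleOne]
    exact Module.Basis.span_eq _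
  · intro i x hx
    have hex : e.symm x = baseChangeMk _ (1 ⊗ₜ augCoords b x) +
        baseChangeMk _ (koszulEps t 𝒜 ⊗ₜ augCoords b (δ x)) :=
      e.symm_apply_eq.2 (hΦinv x).symm
    rw [hex]
    refine add_mem ⟨_, tmul_mem_tensorDeg (SetLike.GradedOne.one_mem) (j := i) ?_ (zero_add _), rfl⟩
      ⟨_, tmul_mem_tensorDeg (koszulEps_mem t 𝒜) (j := i - 1) ?_ (add_sub_cancel _ _), rfl⟩
    · exact kernelIncl_augCoords_mem b h i x hx
    · exact kernelIncl_augCoords_mem b h _ _ (h.map_mem i x hx)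
  · intro x
    refine e.symm_apply_eq.2 ?_
    change 𝒩.d x = Φ (baseChangeD _ ℳ (e.symm x))
    rw [hΦd]
    exact congrArg 𝒩.d (e.apply_symm_apply x).symm

end KoszulLifting

/-! ### Homogeneous bases from semi-bases -/

section HomogeneousBasis

variable {R A : Type*} [CommRing R] [Ring A] [Algebra R A] {𝒜 : DGAlgebra R A}
variable {N : Type*} [AddCommGroup N] [Module R N] [Module A N] [IsScalarTower R A N]

theorem IsDegreewiseFiniteSemifree.exists_basis {𝒩 : DGModule 𝒜 N}
    (hN : 𝒩.IsDegreewiseFiniteSemifree) :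
    ∃ (ι : Type) (b : Module.Basis ι A N) (D : ι → ℤ) (n₀ : ℤ), (∀ i, b i ∈ 𝒩.deg (D i)) ∧
      (∀ i, n₀ ≤ D i) ∧ ∀ k, {i | D i ≤ k}.Finite := by
  obtain ⟨⟨n₀, hn₀⟩, E, hE, hfin⟩ := hN
  have hdeg : ∀ e : E, ∃ i, n₀ ≤ i ∧ (e : N) ∈ 𝒩.deg i := by
    intro e
    obtain ⟨i, hi⟩ := hE.homogeneous e e.2
    by_cases h : n₀ ≤ i
    · exact ⟨i, h, hi⟩
    · rw [hn₀ i (not_le.1 h), Submodule.mem_bot] at hi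
      -- Here e = 0, which linear independence permits only over the zero ring; any degree may be
      -- assigned to it.
      exact ⟨n₀, le_rfl, hi ▸ zero_mem _⟩
  choose D hD hDe using hdeg
  -- The semi-basis is a countable union of finite sets, so it can be indexed in `Type`; the free
  -- A-module on it then stays in the universe of A.
  have hcount : Countable E := by
    have h : E ⊆ ⋃ i : ℤ, E ∩ 𝒩.deg i := fun e he =>
      Set.mem_iUnion.2 ⟨D ⟨e, he⟩, he, hDe ⟨e, he⟩⟩
    exact ((Set.countable_iUnion fun i => (hfin i).countable).mono h).to_subtype
  let b : Module.Basis E A N := Module.Basis.mk hE.linearIndependent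
    (by rw [Subtype.range_coe, hE.span_eq_top])
  have hb : ∀ e : E, b e = e := fun e => Module.Basis.mk_apply _ _ e
  refine ⟨Shrink.{0} E, b.reindex (equivShrink.{0} E), D ∘ (equivShrink.{0} E).symm, n₀, fun i => ?_,
    fun i => hD _, fun k => ?_⟩
  · rw [Module.Basis.reindex_apply, hb]
    exact hDe _
  · have hk : {e : E | D e ≤ k}.Finite := by
      refine Set.Finite.of_finite_image (f := ((↑) : E → N)) ?_ Subtype.val_injective.injOn
      refine ((Set.finite_Icc n₀ k).biUnion fun i _ => hfin i).subset ?_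
      rintro _ ⟨e, he, rfl⟩
      exact Set.mem_biUnion ⟨hD e, he⟩ ⟨e.2, hDe e⟩
    exact Set.Finite.preimage (f := (equivShrink.{0} E).symm) (Equiv.injective _).injOn hk

end HomogeneousBasis

end DGModule

/-! ### The lifting theorem -/

theorem mainTheorem2 {R : Type u} {A : Type v} {N : Type w} {F : Type x}
    [CommRing R] [IsNoetherianRing R] [Ring A] [Algebra R A] (𝒜 : DGAlgebra R A)
    (hA : ∀ i, Module.Free R (𝒜.deg i) ∧ Module.Finite R (𝒜.deg i))
    (t : R) (ht : IsAdicComplete (Ideal.span {t}) R)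
    [AddCommGroup N] [Module R N] [Module ((DGAlgebra.koszul t).TensorType 𝒜) N]
    [IsScalarTower R ((DGAlgebra.koszul t).TensorType 𝒜) N]
    (𝒩 : DGModule ((DGAlgebra.koszul t).tensor 𝒜) N)
    (hN : 𝒩.IsDegreewiseFiniteSemifree)
    [AddCommGroup F] [Module R F] [Module ((DGAlgebra.koszul t).TensorType 𝒜) F]
    [IsScalarTower R ((DGAlgebra.koszul t).TensorType 𝒜) F]
    {ℱ : DGModule ((DGAlgebra.koszul t).tensor 𝒜) F} (ρ : DGModule.SemifreeResolution ℱ 𝒩)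
    (hExt : Subsingleton (DGModule.Ext ρ 𝒩 2)) :
    ∃ (M : Type v) (_ : AddCommGroup M) (_ : Module R M) (_ : Module A M)
      (_ : IsScalarTower R A M) (ℳ : DGModule 𝒜 M),
      ℳ.IsSemifree ∧ DGModule.IsLifting ((DGAlgebra.koszul t).tensorInclude 𝒜) 𝒩 ℳ := by
  obtain ⟨ι, b, D, n₀, hD, hn₀, hfin⟩ := hN.exists_basis
  have := DGAlgebra.koszulTensor_free t 𝒜 fun i => (hA i).1
  have : Module.Free ((DGAlgebra.koszul t).TensorType 𝒜) N := Module.Free.of_basis b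
  -- Freeness over R, obtained through B, makes N t-adically separated, as the limit argument
  -- requires.
  have : Module.Free R N := Module.Free.trans (S := (DGAlgebra.koszul t).TensorType 𝒜)
  obtain ⟨δ, hδ, hdδ, hδδ⟩ := DGModule.exists_isDerivationAlong_mul_self_eq_zero b hD hfin
    (DGAlgebra.koszulTensor_deg_fg t 𝒜 fun i => (hA i).2) ht (DGAlgebra.koszulContraction t 𝒜)
    fun w hw hdw =>
      DGModule.exists_eq_anticommutator_of_subsingleton_ext ρ hExt b hD hn₀ hw hdw
  obtain ⟨ℳ, hℳ, hlift⟩ := DGModule.exists_isLifting b hN.1 hD hδ hδδ hdδ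
  exact ⟨ι →₀ A, inferInstance, inferInstance, inferInstance, inferInstance, ℳ, hℳ, hlift⟩
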